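/- Let $\Omega$ be a finite set of finitary operation symbols not containing $+,-,0$, and let $\Sigma=\{+,-,0\}\cup\Omega$. An $\Omega$-expanded group is a $\Sigma$-algebra $H$ that is a (not necessarily abelian) group under $+$ with inverse operation $-$ and identity element $0$; this group is its additive group. It is distributive if, for every nonnullary $\omega\in\Omega$, the operation $\omega^H$ is distributive over $+$ in each of its arguments. A black-box $\Sigma$-algebra with encoding length $n$ is a pair $(H,\rho)$, where $H$ is a $\Sigma$-algebra and $\rho$ is a function from a subset of $\{0,1\}^n$ onto $H$ (so $H$ is finite); every $\rho$-preimage of $h\in H$ is called a representation of $h$. A $\Sigma$-oracle for $(H,\rho)$, given representations of $h_1,h_2\in H$, decides whether $h_1=h_2$, and, given $\sigma\in\Sigma$ of arity $r$ and representations of $h_1,\dots,h_r\in H$, returns a representation of $\sigma^H(h_1,\dots,h_r)$; its answers to other queries are arbitrary. A probabilistic polynomial-time black-box $\Omega$-expanded group algorithm is a probabilistic algorithm with access to a $\Sigma$-oracle that, when computing in a black-box $\Sigma$-algebra $(H,\rho)$ of encoding length $n$ on input $(1^n,s)$, where $s$ is a tuple of representations of elements of $H$, makes only queries of these two forms and whose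 running time is bounded by a fixed polynomial in the length of the input, whatever the oracle and the outcomes of the coin tosses are. Theorem. Let $\mathfrak V$ be a variety of $\Sigma$-algebras that can be defined by a finite set of identities, such that every member of $\mathfrak V$ is a distributive $\Omega$-expanded group with nilpotent additive group. Let $c>1$ be a real constant. Then there exists a probabilistic polynomial-time black-box $\Omega$-expanded group algorithm $D$ such that the following holds. Suppose $(H,\rho)$ is a black-box $\Sigma$-algebra such that $H$ is a distributive $\Omega$-expanded group, $n$ is its encoding length, $s$ is a tuple of representations of elements that generate $H$ as a $\Sigma$-algebra, and $O$ is a $\Sigma$-oracle for $(H,\rho)$. Then $D$, with access to $O$, on input $(1^n,s)$ correctly decides whether $H\in\mathfrak V$ with probability at least $1-n/c^n$. -/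

import Mathlib

universe u u' v

namespace BlackBoxModel

/-! ### Universal algebra

A set of finitary operation symbols is a first-order language without relation symbols, terms over
the variables `x_0, x_1, …` are `L.Term ℕ`, and an `L`-algebra is an `L.Structure`. -/

/-- A class of `L`-algebras. -/
def AlgClass (L : FirstOrder.Language.{u, u'}) := ∀ (H : Type v) [L.Structure H], Prop

/-- The algebra `H` satisfies the identity `e.1 = e.2` (all variables universally quantified). -/
def Satisfies (L : FirstOrder.Language.{u, u'}) (H : Type v) [L.Structure H] (e : L.Term ℕ × L.Term ℕ) :
    Prop :=
  ∀ a : ℕ → H, e.1.realize a = e.2.realize a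

/-- A class of `L`-algebras is a finitely based variety if it is defined by a finite set of
identities. -/
def IsFinitelyBasedVariety {L : FirstOrder.Language.{u, u'}} (V : AlgClass.{u, u', v} L) : Prop :=
  ∃ B : Set (L.Term ℕ × L.Term ℕ), B.Finite ∧
    ∀ (H : Type v) [L.Structure H], V H ↔ ∀ e ∈ B, Satisfies L H e

/-! ### Expanded groups -/

/-- The operation symbols `+`, `-` (additive inverse) and `0`. -/
inductive GroupSymbol : ℕ → Type
  | add : GroupSymbol 2
  | neg : GroupSymbol 1
  | zero : GroupSymbol 0

/-- The set of operation symbols `{+, -, 0}`. -/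
def groupLang : FirstOrder.Language.{0, 0} := ⟨GroupSymbol, fun _ => Empty⟩

/-- The disjoint union of `{+, -, 0}` and `Ω`. -/
abbrev expLang (Ω : FirstOrder.Language.{u, u'}) : FirstOrder.Language.{u, u'} :=
  FirstOrder.Language.sum groupLang Ω

section Expanded

variable (Ω : FirstOrder.Language.{u, u'}) {H : Type v} [(expLang Ω).Structure H]

/-- The operation `+` of an algebra with operation symbols `{+, -, 0}` and `Ω`. -/
def addOp (a b : H) : H :=
  FirstOrder.Language.Structure.funMap (L := expLang Ω) (n := 2) (Sum.inl GroupSymbol.add) ![a, b]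

/-- The operation `-` of an algebra with operation symbols `{+, -, 0}` and `Ω`. -/
def negOp (a : H) : H :=
  FirstOrder.Language.Structure.funMap (L := expLang Ω) (n := 1) (Sum.inl GroupSymbol.neg) ![a]

variable (H) in
/-- The constant `0` of an algebra with operation symbols `{+, -, 0}` and `Ω`. -/
def zeroOp : H :=
  FirstOrder.Language.Structure.funMap (L := expLang Ω) (n := 0) (Sum.inl GroupSymbol.zero) ![]

/-- The fundamental operation associated with a symbol in `Ω`. -/
def omegaOp {k : ℕ} (ω : Ω.Functions k) (h : Fin k → H) : H :=
  FirstOrder.Language.Structure.funMap (L := expLang Ω) (n := k) (Sum.inr ω) h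

variable (H) in
/-- `H` is an `Ω`-expanded group: it is a group under `+` with inverse operation `-` and
identity element `0`. -/
structure IsExpandedGroup : Prop where
  add_assoc : ∀ a b c : H, addOp Ω (addOp Ω a b) c = addOp Ω a (addOp Ω b c)
  zero_add : ∀ a : H, addOp Ω (zeroOp Ω H) a = a
  add_zero : ∀ a : H, addOp Ω a (zeroOp Ω H) = a
  neg_add : ∀ a : H, addOp Ω (negOp Ω a) a = zeroOp Ω H
  add_neg : ∀ a : H, addOp Ω a (negOp Ω a) = zeroOp Ω H

variable {Ω} in
/-- The additive group of an `Ω`-expanded group. -/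
abbrev IsExpandedGroup.addGroup (h : IsExpandedGroup Ω H) : AddGroup H :=
  letI : Add H := ⟨addOp Ω⟩
  letI : Neg H := ⟨negOp Ω⟩
  letI : Zero H := ⟨zeroOp Ω H⟩
  AddGroup.ofLeftAxioms h.add_assoc h.zero_add h.neg_add

variable (H) in
/-- `H` is an `Ω`-expanded group whose additive group is nilpotent. -/
def HasNilpotentAddGroup : Prop :=
  ∃ h : IsExpandedGroup Ω H, @AddGroup.IsNilpotent H h.addGroup

variable (H) in
/-- `H` is a distributive `Ω`-expanded group: each fundamental operation associated with a
nonnullary symbol in `Ω` is distributive over `+` in each of its arguments. -/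
structure IsDistributive : Prop where
  isExpandedGroup : IsExpandedGroup Ω H
  distrib : ∀ {k : ℕ} (ω : Ω.Functions k) (i : Fin k) (h : Fin k → H) (a b : H),
    omegaOp Ω ω (Function.update h i (addOp Ω a b)) =
      addOp Ω (omegaOp Ω ω (Function.update h i a)) (omegaOp Ω ω (Function.update h i b))

end Expanded

/-! ### Black-box algebras and their oracles -/

/-- A black-box `L`-algebra `(H, rep)` with encoding length `n`: `rep` is a function from a set
`dom` of bit strings of length `n` onto `H`. (In particular, `H` is finite.) -/
structure BlackBox (H : Type v) (n : ℕ) where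
  dom : Set (List Bool)
  length_eq : ∀ w ∈ dom, w.length = n
  rep : dom → H
  surjective : Function.Surjective rep

/-- What an oracle answers to the queries `(=, w₁, w₂)` and `(f, w₁, …, w_k)`. -/
structure Oracle (L : FirstOrder.Language.{u, u'}) where
  eqv : List Bool → List Bool → Bool
  op : ∀ {k : ℕ}, L.Functions k → (Fin k → List Bool) → List Bool

/-- `O` is an oracle for the black-box `L`-algebra `(H, rep)`: on representations of elements of
`H` it decides equality and returns representations of the values of the fundamental operations.
There is no condition on its other answers. -/
structure BlackBox.IsOracle {L : FirstOrder.Language.{u, u'}} {H : Type v} [L.Structure H] {n : ℕ}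
    (B : BlackBox H n) (O : Oracle L) : Prop where
  eqv : ∀ w₁ w₂ : B.dom, O.eqv w₁ w₂ = true ↔ B.rep w₁ = B.rep w₂
  op : ∀ {k : ℕ} (f : L.Functions k) (w : Fin k → B.dom),
    ∃ hw : O.op f (fun i => (w i : List Bool)) ∈ B.dom,
      B.rep ⟨_, hw⟩ = FirstOrder.Language.Structure.funMap f (fun i => B.rep (w i))

/-! ### The machine model

Programs are `while` programs over finitely many registers that hold binary trees, with
instructions for tossing a fair coin and for querying the oracle. Every instruction that stores a
tree costs one more than the size of this tree, and every test costs one, so that running times are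
polynomially related to those of probabilistic oracle Turing machines. -/

/-- Binary trees, the data that programs work with. -/
inductive Data : Type
  | nil : Data
  | cons : Data → Data → Data

namespace Data

/-- The number of nodes. -/
def size : Data → ℕ
  | nil => 1
  | cons a b => 1 + a.size + b.size

/-- The first component. -/
def hd : Data → Data
  | nil => nil
  | cons a _ => a

/-- The second component. -/
def tl : Data → Data
  | nil => nil
  | cons _ b => b

/-- The encoding of a bit. -/
def bit : Bool → Data
  | false => nil
  | true => cons nil nil

/-- The encoding of a finite list. -/
def list : List Data → Data
  | [] => nil
  | a :: l => cons a (list l)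

/-- The encoding of a bit string. -/
def word (w : List Bool) : Data := list (w.map bit)

/-- The encoding of the input `(1^n, s)`, where `s` is a tuple of bit strings. -/
def input (n : ℕ) (s : List (List Bool)) : Data :=
  cons (word (List.replicate n true)) (list (s.map word))

end Data

/-- The contents of the registers. -/
abbrev Store := ℕ → Data

/-- Expressions. -/
inductive Expr : Type
  | var : ℕ → Expr
  | nil : Expr
  | cons : Expr → Expr → Expr
  | hd : Expr → Expr
  | tl : Expr → Expr

/-- The value of an expression. -/
def Expr.eval (st : Store) : Expr → Data
  | var i => st i
  | nil => Data.nil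
  | cons e₁ e₂ => Data.cons (e₁.eval st) (e₂.eval st)
  | hd e => (e.eval st).hd
  | tl e => (e.eval st).tl

/-- Probabilistic programs with access to an oracle for equality and the operations in `L`. -/
inductive Prog (L : FirstOrder.Language.{u, u'}) : Type u
  /-- store the value of an expression in register `x` -/
  | assign (x : ℕ) (e : Expr) : Prog L
  /-- sequential composition -/
  | seq (P Q : Prog L) : Prog L
  /-- run `P` if the value of `e` is not `nil`, and `Q` otherwise -/
  | cond (e : Expr) (P Q : Prog L) : Prog L
  /-- run `P` as long as the value of `e` is not `nil` -/
  | loop (e : Expr) (P : Prog L) : Prog L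
  /-- store a random bit in register `x` -/
  | toss (x : ℕ) : Prog L
  /-- store the oracle's answer to the query `(=, e₁, e₂)` in register `x` -/
  | queryEq (x : ℕ) (e₁ e₂ : Expr) : Prog L
  /-- store the oracle's answer to the query `(f, e₁, …, e_k)` in register `x` -/
  | queryOp (x : ℕ) {k : ℕ} (f : L.Functions k) (e : Fin k → Expr) : Prog L

section Exec

variable {L : FirstOrder.Language.{u, u'}} (E : Set (List Bool)) (O : Oracle L)

/-- `Exec E O P st r st' r' t`: started with the store `st` and the outcomes `r` of the coming coin
tosses, `P` halts after time `t` with the store `st'`, and `r'` is the unused part of `r`.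
The only queries that can be made are those about bit strings in `E`; a computation that attempts
another query does not halt. -/
inductive Exec : Prog L → Store → List Bool → Store → List Bool → ℕ → Prop
  | assign (x : ℕ) (e : Expr) (st : Store) (r : List Bool) :
      Exec (.assign x e) st r (Function.update st x (e.eval st)) r (1 + (e.eval st).size)
  | seq {P Q : Prog L} {st st' st'' : Store} {r r' r'' : List Bool} {t t' : ℕ} :
      Exec P st r st' r' t → Exec Q st' r' st'' r'' t' →
      Exec (.seq P Q) st r st'' r'' (t + t')
  | cond_true {e : Expr} {P Q : Prog L} {st st' : Store} {r r' : List Bool} {t : ℕ} :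
      e.eval st ≠ Data.nil → Exec P st r st' r' t →
      Exec (.cond e P Q) st r st' r' (1 + t)
  | cond_false {e : Expr} {P Q : Prog L} {st st' : Store} {r r' : List Bool} {t : ℕ} :
      e.eval st = Data.nil → Exec Q st r st' r' t →
      Exec (.cond e P Q) st r st' r' (1 + t)
  | loop_true {e : Expr} {P : Prog L} {st st' st'' : Store} {r r' r'' : List Bool} {t t' : ℕ} :
      e.eval st ≠ Data.nil → Exec P st r st' r' t →
      Exec (.loop e P) st' r' st'' r'' t' →
      Exec (.loop e P) st r st'' r'' (1 + t + t')
  | loop_false {e : Expr} {P : Prog L} {st : Store} {r : List Bool} :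
      e.eval st = Data.nil → Exec (.loop e P) st r st r 1
  | toss (x : ℕ) (st : Store) (b : Bool) (r : List Bool) :
      Exec (.toss x) st (b :: r) (Function.update st x (Data.bit b)) r (1 + (Data.bit b).size)
  | queryEq (x : ℕ) {e₁ e₂ : Expr} {st : Store} (r : List Bool) {w₁ w₂ : List Bool} :
      w₁ ∈ E → w₂ ∈ E → e₁.eval st = Data.word w₁ → e₂.eval st = Data.word w₂ →
      Exec (.queryEq x e₁ e₂) st r (Function.update st x (Data.bit (O.eqv w₁ w₂))) r
        (1 + (Data.bit (O.eqv w₁ w₂)).size)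
  | queryOp (x : ℕ) {k : ℕ} (f : L.Functions k) {e : Fin k → Expr} {st : Store} (r : List Bool)
      {w : Fin k → List Bool} :
      (∀ i, w i ∈ E) → (∀ i, (e i).eval st = Data.word (w i)) →
      Exec (.queryOp x f e) st r (Function.update st x (Data.word (O.op f w))) r
        (1 + (Data.word (O.op f w)).size)

/-- On input `d` (in register `0`, all other registers being `nil`) and with the outcomes `r` of
the coin tosses, `P` halts within time `T` with output `out` (in register `0`). -/
def HaltsWith (P : Prog L) (d : Data) (r : List Bool) (T : ℕ) (out : Data) : Prop :=
  ∃ st' r' t, Exec E O P (Function.update (fun _ => Data.nil) 0 d) r st' r' t ∧ t ≤ T ∧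
    st' 0 = out

/-- The probability that `P` on input `d` halts within time `T` with output `out`, where the
outcomes of the coin tosses (of which at most `T` can be made within this time) are independent
and uniformly distributed. -/
noncomputable def outputProb (P : Prog L) (d : Data) (T : ℕ) (out : Data) : ℝ :=
  ({r : Fin T → Bool | HaltsWith E O P d (List.ofFn r) T out}.ncard : ℝ) / 2 ^ T

end Exec

/-- `P` is a probabilistic black-box `L`-algebra algorithm (with inputs of the form `(1^n, s)`)
with running time bounded by `p` in the length of the input: in every black-box `L`-algebra with
any oracle for it, on every input `(1^n, s)` with `s` a tuple of representations of elements, and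
for all outcomes of the coin tosses, `P` queries the oracle only about representations of elements
and halts within the time bound. -/
def IsBlackBoxAlgorithm {L : FirstOrder.Language.{u, u'}} (P : Prog L) (p : Polynomial ℕ) : Prop :=
  ∀ (H : Type v) [L.Structure H] (n : ℕ) (B : BlackBox H n) (O : Oracle L), B.IsOracle O →
    ∀ s : List B.dom,
      let d := Data.input n (s.map Subtype.val)
      ∀ r : List Bool, r.length = p.eval d.size →
        ∃ out, HaltsWith B.dom O P d r (p.eval d.size) out

/-- The tuple `s` of representations represents a generating system of the `L`-algebra `H`. -/
def Generates (L : FirstOrder.Language.{u, u'}) {H : Type v} [L.Structure H] {n : ℕ} (B : BlackBox H n)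
    (s : List B.dom) : Prop :=
  FirstOrder.Language.Substructure.closure L {h : H | ∃ w ∈ s, B.rep w = h} = ⊤

open Classical in
/-- The answer to the question whether a proposition holds, encoded as a bit. -/
noncomputable def answer (q : Prop) : Data := Data.bit (decide q)

end BlackBoxModel

namespace BlackBoxModel

/-! ### Polynomial maps with respect to a filtration -/

section Poly

open scoped commutatorElement

variable {G : Type*} [Group G]

/-! Varieties are closed under products, so the nilpotency classes of the additive groups in the
variety have a common bound `d`. Hence a left-normed commutator law may be adjoined to the finite
basis, and what has to be decided is whether `H` satisfies finitely many fixed identities. A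
satisfied identity is never seen to fail, so errors occur only for nonmembers.

The algorithm first turns the generators of the algebra into generators of its additive group. Let
`A` be the additive subgroup spanned so far. If `A` is proper, some operation leads from `A` outside
of `A`. Fixing all arguments but one gives an additive homomorphism, and a random subsum of
generators lies in a given proper subgroup with probability at most 1/2. Hence a random value of a
`k`-ary operation leaves `A` with probability at least `2 ^ (-k)`, and then the index is at least
halved (`E_draw_omega_le`, `E_grow_le`). The index is at most `2 ^ n`, so linearly many rounds make
it exponentially unlikely that `A` is still proper.

Then identities are checked at random sums of the additive generators. If the class exceeds `d`, the
commutator law fails with constant probability, by climbing down the upper central series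
(`E_draw_leftComm_le`). Otherwise each term is, in each variable, a polynomial map for a filtration
of the additive group of length depending only on `d` and the term (`isPoly_realize`): polynomial
maps are closed under the group operations, and distributive operations preserve them once the lower
central series is slowed down enough. A nontrivial map killed by `r` derivatives is nontrivial at a
random subproduct with probability at least `2 ^ (-r)`, a noncommutative Schwartz–Zippel lemma
(`E_subsum_eq_one_le`). Choosing the variables one after the other detects a failing identity with
constant probability (`E_draw_realize_le`), and linearly many repetitions amplify this.

The probabilistic analysis is done for coin-toss trees (`Coin`). `Impl` says that a concrete program
carries out such a tree within a time bound. The oracle makes the set of representations an algebra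
of which `H` is a homomorphic image, so the tree is a computation with representations. -/

theorem commutator_commutator_le_of_rotate {A B C N : Subgroup G} [N.Normal]
    (h1 : ⁅⁅B, C⁆, A⁆ ≤ N) (h2 : ⁅⁅C, A⁆, B⁆ ≤ N) : ⁅⁅A, B⁆, C⁆ ≤ N := by
  have key : ∀ K : Subgroup G, K ≤ N ↔ K.map (QuotientGroup.mk' N) = ⊥ := fun K => by
    rw [Subgroup.map_eq_bot_iff, QuotientGroup.ker_mk']
  rw [key, Subgroup.map_commutator, Subgroup.map_commutator] at h1 h2 ⊢
  exact Subgroup.commutator_commutator_eq_bot_of_rotate h1 h2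

/-- Induction on `j` by the three subgroups lemma. The series is indexed from 0, whence the extra 1.
-/
theorem commutator_lowerCentralSeries_le (i j : ℕ) :
    ⁅(⊤ : Subgroup G).lowerCentralSeries i, (⊤ : Subgroup G).lowerCentralSeries j⁆ ≤
      (⊤ : Subgroup G).lowerCentralSeries (i + j + 1) := by
  induction j generalizing i with
  | zero => exact le_of_eq (Subgroup.lowerCentralSeries_succ _ _).symm
  | succ j ih =>
    rw [Subgroup.lowerCentralSeries_succ _ j, Subgroup.commutator_comm]
    refine commutator_commutator_le_of_rotate ?_ ?_
    · rw [Subgroup.commutator_comm ⊤, ← Subgroup.lowerCentralSeries_succ]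
      exact (ih (i + 1)).trans (le_of_eq (by congr 1; omega))
    · refine (Subgroup.commutator_mono (ih i) le_rfl).trans (le_of_eq ?_)
      rw [← Subgroup.lowerCentralSeries_succ]; congr 1

/-- A decreasing sequence of subgroups, starting with the whole group, with
`⁅F i, F j⁆ ≤ F (i + j)`. -/
structure IsFiltration (F : ℕ → Subgroup G) : Prop where
  anti : Antitone F
  comm : ∀ i j, ⁅F i, F j⁆ ≤ F (i + j)
  one : F 1 = ⊤

/-- The multiplicative derivative of `f` in direction `h`. -/
def rdiff (h : G) (f : G → G) : G → G := fun x => (f x)⁻¹ * f (x * h)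

/-- For `m ≤ n`, all `m`-fold derivatives of `f` take values in `F (i + m)`. -/
def IsPoly (F : ℕ → Subgroup G) : ℕ → ℕ → (G → G) → Prop
  | 0, i, f => ∀ x, f x ∈ F i
  | n + 1, i, f => (∀ x, f x ∈ F i) ∧ ∀ h, IsPoly F n (i + 1) (rdiff h f)

namespace IsPoly

variable {F : ℕ → Subgroup G} {n i j : ℕ} {f g : G → G}

theorem mem (hf : IsPoly F n i f) (x : G) : f x ∈ F i := by
  cases n with
  | zero => exact hf x
  | succ n => exact hf.1 x

theorem of_succ (hf : IsPoly F (n + 1) i f) : IsPoly F n i f := by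
  induction n generalizing i f with
  | zero => exact hf.1
  | succ n ih => exact ⟨hf.1, fun h => ih (hf.2 h)⟩

theorem mono {F' : ℕ → Subgroup G} {k : ℕ} (hF : ∀ m, F (i + m) ≤ F' (k + m))
    (hf : IsPoly F n i f) : IsPoly F' n k f := by
  induction n generalizing i k f with
  | zero => exact fun x => hF 0 (hf x)
  | succ n ih =>
    refine ⟨fun x => hF 0 (hf.1 x), fun h => ih (fun m => ?_) (hf.2 h)⟩
    rw [add_assoc i, add_assoc k]; exact hF _

theorem of_le (hF : Antitone F) (hij : j ≤ i) (hf : IsPoly F n i f) : IsPoly F n j f :=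
  hf.mono fun m => hF (by omega)

theorem const {a : G} (ha : a ∈ F i) (n : ℕ) : IsPoly F n i fun _ => a := by
  have h1 : ∀ n i, IsPoly F n i fun _ => 1 := by
    intro n
    induction n with
    | zero => exact fun i x => one_mem _
    | succ n ih =>
      refine fun i => ⟨fun x => one_mem _, fun h => ?_⟩
      have : rdiff h (fun _ : G => (1 : G)) = fun _ => 1 := by funext x; simp [rdiff]
      rw [this]; exact ih _
  cases n with
  | zero => exact fun x => ha
  | succ n =>
    refine ⟨fun x => ha, fun h => ?_⟩
    have : rdiff h (fun _ : G => a) = fun _ => 1 := by funext x; simp [rdiff]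
    rw [this]; exact h1 _ _

theorem ident (hF : IsFiltration F) (n : ℕ) : IsPoly F n 0 fun x => x := by
  have h0 : ∀ x, x ∈ F 0 := fun x => hF.anti zero_le_one (hF.one ▸ Subgroup.mem_top x)
  cases n with
  | zero => exact h0
  | succ n =>
    refine ⟨h0, fun h => ?_⟩
    have : rdiff h (fun x : G => x) = fun _ => h := by funext x; simp [rdiff]
    rw [this]; exact const (by rw [hF.one]; exact Subgroup.mem_top h) n

/-- The derivative of a translate by `l` in direction `h` is the translate of the derivative in
direction `l⁻¹ * h * l`. -/
theorem shift (hf : IsPoly F n i f) (l : G) : IsPoly F n i fun x => f (x * l) := by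
  induction n generalizing i f with
  | zero => exact fun x => hf _
  | succ n ih =>
    refine ⟨fun x => hf.1 _, fun h => ?_⟩
    have := ih (hf.2 (l⁻¹ * h * l))
    convert this using 2 with x
    simp [rdiff, mul_assoc]

/-- The derivatives of a product, an inverse and a commutator involve conjugates, and a conjugate is
`⁅f, g⁆ * g`. So the three closure properties need each other and are proved by one induction on the
number of derivatives. `of_succ` lowers this number for the factors that are not differentiated. -/
theorem group_closure (hF : IsFiltration F) (n : ℕ) :
    (∀ i f g, IsPoly F n i f → IsPoly F n i g → IsPoly F n i fun x => f x * g x) ∧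
    (∀ i f, IsPoly F n i f → IsPoly F n i fun x => (f x)⁻¹) ∧
    (∀ i j f g, IsPoly F n i f → IsPoly F n j g → IsPoly F n (i + j) fun x => ⁅f x, g x⁆) := by
  induction n with
  | zero =>
    exact ⟨fun i f g hf hg x => mul_mem (hf x) (hg x), fun i f hf x => inv_mem (hf x),
      fun i j f g hf hg x => hF.comm i j (Subgroup.commutator_mem_commutator (hf x) (hg x))⟩
  | succ n ih =>
    obtain ⟨hmul, hinv, hcomm⟩ := ih
    have hconj : ∀ i j f g, IsPoly F n i f → IsPoly F n j g →
        IsPoly F n j fun x => f x * g x * (f x)⁻¹ := by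
      intro i j f g hf hg
      have := hmul _ _ _ ((hcomm _ _ _ _ hf hg).of_le hF.anti (by omega)) hg
      convert this using 2 with x
      simp [commutatorElement_def]
    refine ⟨fun i f g hf hg => ⟨fun x => mul_mem (hf.1 x) (hg.1 x), fun h => ?_⟩,
      fun i f hf => ⟨fun x => inv_mem (hf.1 x), fun h => ?_⟩,
      fun i j f g hf hg => ⟨fun x => hF.comm i j
        (Subgroup.commutator_mem_commutator (hf.1 x) (hg.1 x)), fun h => ?_⟩⟩
    -- Product rule: `∂(f g) = (g⁻¹ ∂f g) ∂g`.
    · have := hmul _ _ _ (hconj _ _ _ _ (hinv _ _ hg.of_succ) (hf.2 h)) (hg.2 h)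
      convert this using 2 with x
      simp [rdiff, mul_assoc]
    -- `∂(f⁻¹) = f (∂f)⁻¹ f⁻¹`.
    · have := hconj _ _ _ _ hf.of_succ (hinv _ _ (hf.2 h))
      convert this using 2 with x
      simp [rdiff, mul_assoc]
    -- With `g'` the translate of `g` by `h`, `∂⁅f, g⁆` is the conjugate of `X = f ⁅∂f, g'⁆ f⁻¹` by
    -- `⁅f, g⁆⁻¹`, times `Y = g ⁅f, ∂g⁆ g⁻¹`. Both factors have level `i + j + 1`.
    · have hX := hconj _ _ _ _ hf.of_succ (hcomm _ _ _ _ (hf.2 h) (hg.of_succ.shift h))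
      have hY := hconj _ _ _ _ hg.of_succ (hcomm _ _ _ _ hf.of_succ (hg.2 h))
      have hX' := hconj _ _ _ _ (hinv _ _ (hcomm _ _ _ _ hf.of_succ hg.of_succ)) hX
      have := hmul _ _ _ (hX'.of_le hF.anti (by omega : i + j + 1 ≤ _))
        (hY.of_le hF.anti (by omega))
      convert this using 2 with x
      simp only [rdiff, commutatorElement_def]
      group

theorem mul (hF : IsFiltration F) (hf : IsPoly F n i f) (hg : IsPoly F n i g) :
    IsPoly F n i fun x => f x * g x := (group_closure hF n).1 i f g hf hg

theorem inv (hF : IsFiltration F) (hf : IsPoly F n i f) : IsPoly F n i fun x => (f x)⁻¹ :=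
  (group_closure hF n).2.1 i f hf

end IsPoly

/-- The lower central series, slowed down by the factor `D`. -/
def slowSeries (G : Type*) [Group G] (D i : ℕ) : Subgroup G :=
  (⊤ : Subgroup G).lowerCentralSeries ((i - 1) / D)

/-- Truncated subtraction puts the whole group at levels 0 and 1. For the commutators, the 1 gained
in `commutator_lowerCentralSeries_le` compensates for the rounding down of the two quotients. -/
theorem isFiltration_slowSeries {D : ℕ} (hD : 0 < D) : IsFiltration (slowSeries G D) where
  anti i j hij := Subgroup.lowerCentralSeries_antitone _ (Nat.div_le_div_right (by omega))
  comm i j := by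
    refine (commutator_lowerCentralSeries_le _ _).trans
      (Subgroup.lowerCentralSeries_antitone _ ?_)
    rw [← Nat.lt_succ_iff, Nat.div_lt_iff_lt_mul hD]
    have h1 := Nat.lt_mul_div_succ (i - 1) hD
    have h2 := Nat.lt_mul_div_succ (j - 1) hD
    generalize (i - 1) / D = a at *
    generalize (j - 1) / D = b at *
    have : (a + b + 1).succ * D = D * (a + 1) + D * (b + 1) := by
      simp only [Nat.succ_eq_add_one]; ring
    omega
  one := by simp [slowSeries]

theorem slowSeries_le {D D' : ℕ} (hD : 0 < D) (h : D ≤ D') (i : ℕ) :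
    slowSeries G D i ≤ slowSeries G D' i :=
  Subgroup.lowerCentralSeries_antitone _ (Nat.div_le_div_left h hD)

theorem slowSeries_eq_bot {D d i : ℕ} (hD : 0 < D)
    (hd : (⊤ : Subgroup G).lowerCentralSeries d = ⊥) (hi : d * D < i) :
    slowSeries G D i = ⊥ := by
  refine le_bot_iff.1 (hd ▸ Subgroup.lowerCentralSeries_antitone _ ?_)
  rw [Nat.le_div_iff_mul_le hD]; omega

/-- If `ω` is distributive in each argument, and the `f i` are polynomial maps of level `a i`, then
`ω (f₀, f₁, …)` is a polynomial map of level `∑ a i`. -/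
theorem IsPoly.multilinear {F F' : ℕ → Subgroup G} (hF' : IsFiltration F') {k : ℕ}
    {ω : (Fin k → G) → G}
    (hω : ∀ (i : Fin k) (h : Fin k → G) (a b : G), ω (Function.update h i (a * b)) =
      ω (Function.update h i a) * ω (Function.update h i b))
    (hωF : ∀ (a : Fin k → ℕ) (h : Fin k → G), (∀ i, h i ∈ F (a i)) → ω h ∈ F' (∑ i, a i))
    {n : ℕ} {a : Fin k → ℕ} {f : Fin k → G → G} (hf : ∀ i, IsPoly F n (a i) (f i)) :
    IsPoly F' n (∑ i, a i) fun x => ω fun i => f i x := by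
  induction n generalizing a f with
  | zero => exact fun x => hωF a _ fun i => hf i x
  | succ n ih =>
    refine ⟨fun x => hωF a _ fun i => (hf i).1 x, fun h => ?_⟩
    -- Telescoping: `y j x` has its first `j` arguments already moved from `x` to `x * h`. Moving
    -- one more argument multiplies the value of `ω` by a value in which that argument is replaced
    -- by its derivative, which raises the level by 1.
    let y : ℕ → G → Fin k → G := fun j x i => if (i : ℕ) < j then f i (x * h) else f i x
    have key : ∀ j ≤ k, IsPoly F' n ((∑ i, a i) + 1)
        fun x => (ω (y 0 x))⁻¹ * ω (y j x) := by
      intro j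
      induction j with
      | zero => intro _; simpa using IsPoly.const (one_mem _) n
      | succ j ihj =>
        intro hj
        let J : Fin k := ⟨j, hj⟩
        have h1 : IsPoly F' n (∑ i, Function.update a J (a J + 1) i)
            fun x => ω fun i => Function.update (fun i x => y j x i) J (rdiff h (f J)) i x := by
          refine ih fun i => ?_
          by_cases hi : i = J
          · subst hi; simpa using (hf _).2 h
          · simp only [Function.update_of_ne hi]
            by_cases hij : (i : ℕ) < j
            · simpa [y, hij] using (hf i).of_succ.shift h
            · simpa [y, hij] using (hf i).of_succ
        have h2 : ∑ i, Function.update a J (a J + 1) i = (∑ i, a i) + 1 := by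
          rw [Finset.sum_update_of_mem (Finset.mem_univ J),
            ← Finset.add_sum_erase _ _ (Finset.mem_univ J), Finset.sdiff_singleton_eq_erase]
          ring
        rw [h2] at h1
        convert (ihj (by omega)).mul hF' h1 using 2 with x
        have e1 : y j x = Function.update (y j x) J (f J x) := by
          funext i
          by_cases hi : i = J
          · subst hi; simp [y, J]
          · simp [hi]
        have e2 : y (j + 1) x = Function.update (y j x) J (f J x * rdiff h (f J) x) := by
          funext i
          by_cases hi : i = J
          · subst hi; simp [y, J, rdiff]
          · have : (i : ℕ) ≠ j := fun h => hi (Fin.ext h)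
            simp only [Function.update_of_ne hi, y]
            have : (i : ℕ) < j + 1 ↔ (i : ℕ) < j := by omega
            simp [this]
        have e3 : (fun i => Function.update (fun i x => y j x i) J (rdiff h (f J)) i x) =
            Function.update (y j x) J (rdiff h (f J) x) := by
          funext i
          by_cases hi : i = J
          · subst hi; simp
          · simp [hi]
        rw [e3, e2, hω, ← e1]; group
    have hk := key k le_rfl
    simp only [y, Fin.is_lt, if_true, Nat.not_lt_zero, if_false] at hk
    exact hk

/-- The operation need not respect the lower central series, but the slow factor `D'` makes this
harmless. Up to total level `k * (d * D)` the target is still the whole group. Beyond it some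
argument has level above `d * D`, hence is trivial, and distributivity in this argument makes the
value trivial. -/
theorem multilinear_slowSeries {d D D' k : ℕ} (hD : 0 < D)
    (hd : (⊤ : Subgroup G).lowerCentralSeries d = ⊥) (hD' : k * (d * D) ≤ D')
    {ω : (Fin k → G) → G}
    (hω : ∀ (i : Fin k) (h : Fin k → G) (a b : G), ω (Function.update h i (a * b)) =
      ω (Function.update h i a) * ω (Function.update h i b))
    (a : Fin k → ℕ) (h : Fin k → G) (hh : ∀ i, h i ∈ slowSeries G D (a i)) :
    ω h ∈ slowSeries G D' (∑ i, a i) := by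
  by_cases hs : ∑ i, a i ≤ k * (d * D)
  · have : (∑ i, a i - 1) / D' = 0 := by
      rw [Nat.div_eq_zero_iff]; omega
    rw [slowSeries, this]; exact Subgroup.mem_top _
  · have : ∃ i, d * D < a i := by
      by_contra! hc
      refine hs ((Finset.sum_le_sum fun i _ => hc i).trans ?_)
      simp
    obtain ⟨i, hi⟩ := this
    have hi1 : h i = 1 := by
      have := hh i
      rwa [slowSeries_eq_bot hD hd hi, Subgroup.mem_bot] at this
    have : ω (Function.update h i (1 * 1)) = ω (Function.update h i 1) * ω (Function.update h i 1) :=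
      hω i h 1 1
    rw [one_mul, ← hi1, Function.update_eq_self] at this
    rw [left_eq_mul.1 this]
    exact one_mem _

end Poly

/-! ### Random computations as trees of coin tosses -/

/-- A random computation with values in `α`. -/
inductive Coin (α : Type) : Type
  | pure (a : α) : Coin α
  | flip (x y : Coin α) : Coin α

/-- The indicator of a proposition. -/
noncomputable def ind (p : Prop) : ℝ := open Classical in if p then 1 else 0

theorem ind_le_one (p : Prop) : ind p ≤ 1 := by unfold ind; split_ifs <;> norm_num

theorem ind_nonneg (p : Prop) : 0 ≤ ind p := by unfold ind; split_ifs <;> norm_num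

theorem ind_true {p : Prop} (h : p) : ind p = 1 := by simp [ind, h]

theorem ind_false {p : Prop} (h : ¬ p) : ind p = 0 := by simp [ind, h]

theorem ind_mono {p q : Prop} (h : p → q) : ind p ≤ ind q := by
  by_cases hp : p
  · rw [ind_true hp, ind_true (h hp)]
  · rw [ind_false hp]; exact ind_nonneg q

namespace Coin

variable {α β : Type}

/-- Use the value of a random computation in another one. -/
def bind : Coin α → (α → Coin β) → Coin β
  | pure a, f => f a
  | flip x y, f => flip (x.bind f) (y.bind f)

/-- The value for given outcomes of the coin tosses, and the unused outcomes. -/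
def run : Coin α → List Bool → Option (α × List Bool)
  | pure a, r => some (a, r)
  | flip _ _, [] => none
  | flip x y, b :: r => if b then y.run r else x.run r

/-- The expected value of `f`. -/
noncomputable def E : Coin α → (α → ℝ) → ℝ
  | pure a, f => f a
  | flip x y, f => (x.E f + y.E f) / 2

/-- The set of possible values. -/
def support : Coin α → Set α
  | pure a => {a}
  | flip x y => x.support ∪ y.support

/-- Iterate a random transformation. -/
def iter (f : α → Coin α) : ℕ → α → Coin α
  | 0, a => pure a
  | n + 1, a => (f a).bind (iter f n)

theorem run_bind (c : Coin α) (f : α → Coin β) (r : List Bool) :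
    (c.bind f).run r = (c.run r).bind fun p => (f p.1).run p.2 := by
  induction c generalizing r with
  | pure a => rfl
  | flip x y hx hy =>
    cases r with
    | nil => rfl
    | cons b r => cases b <;> simp [bind, run, hx, hy]

theorem E_bind (c : Coin α) (f : α → Coin β) (g : β → ℝ) :
    (c.bind f).E g = c.E fun a => (f a).E g := by
  induction c with
  | pure a => rfl
  | flip x y hx hy => simp [bind, E, hx, hy]

theorem bind_pure (c : Coin α) : c.bind pure = c := by
  induction c with
  | pure a => rfl
  | flip x y hx hy => simp [bind, hx, hy]

theorem mem_support_bind {c : Coin α} {f : α → Coin β} {a : α} {b : β} (ha : a ∈ c.support)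
    (hb : b ∈ (f a).support) : b ∈ (c.bind f).support := by
  induction c with
  | pure a' => cases ha; exact hb
  | flip x y hx hy => exact ha.imp hx hy

theorem E_mono {c : Coin α} {f g : α → ℝ} (h : ∀ a ∈ c.support, f a ≤ g a) : c.E f ≤ c.E g := by
  induction c with
  | pure a => exact h a rfl
  | flip x y hx hy =>
    have := hx fun a ha => h a (Or.inl ha)
    have := hy fun a ha => h a (Or.inr ha)
    simp only [E]; linarith

theorem E_affine (c : Coin α) (p q : ℝ) (f : α → ℝ) :
    (c.E fun a => p + q * f a) = p + q * c.E f := by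
  induction c with
  | pure a => rfl
  | flip x y hx hy => simp only [E, hx, hy]; ring

theorem E_const (c : Coin α) (p : ℝ) : (c.E fun _ => p) = p := by
  simpa using c.E_affine p 0 fun _ => 0

theorem E_le {c : Coin α} {f : α → ℝ} {b : ℝ} (h : ∀ a ∈ c.support, f a ≤ b) : c.E f ≤ b :=
  (E_mono h).trans_eq (c.E_const b)

theorem sum_ofFn_succ (T : ℕ) (g : List Bool → ℝ) :
    ∑ r : Fin (T + 1) → Bool, g (List.ofFn r) =
      ∑ r : Fin T → Bool, g (false :: List.ofFn r) + ∑ r : Fin T → Bool, g (true :: List.ofFn r) := by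
  rw [← (Fin.consEquiv fun _ => Bool).sum_comp, Fintype.sum_prod_type, Fintype.sum_bool, add_comm]
  simp [Fin.consEquiv, List.ofFn_succ]

/-- If `T` coin tosses are sufficient, then the expected value is an average over all sequences of
outcomes of `T` coin tosses. -/
theorem sum_run (c : Coin α) (Q : α → Prop) (T : ℕ)
    (hc : ∀ r : List Bool, r.length = T → ∃ a r', c.run r = some (a, r')) :
    ∑ r : Fin T → Bool, ind (∃ a r', c.run (List.ofFn r) = some (a, r') ∧ Q a) =
      2 ^ T * c.E fun a => ind (Q a) := by
  induction c generalizing T with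
  | pure a =>
    simp [run, E]
  | flip x y hx hy =>
    cases T with
    | zero =>
      obtain ⟨a, r', h⟩ := hc [] rfl
      simp [run] at h
    | succ T =>
      rw [sum_ofFn_succ T fun l => ind (∃ a r', (flip x y).run l = some (a, r') ∧ Q a)]
      have h1 := hx T fun r hr => by simpa [run] using hc (false :: r) (by simp [hr])
      have h2 := hy T fun r hr => by simpa [run] using hc (true :: r) (by simp [hr])
      simp only [run, Bool.false_eq_true, if_false, if_true, E]
      rw [h1, h2]; ring

end Coin

open Coin

/-! ### Random subproducts -/

section Sample

variable {W : Type} (add : W → W → W)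

/-- Add a random subsum of `L` to `acc`. -/
def subsum : List W → W → Coin W
  | [], acc => .pure acc
  | l :: L, acc => .flip (subsum L acc) (subsum L (add acc l))

/-- Add `R` random subsums of `L` to `acc`. -/
def sample (L : List W) : ℕ → W → Coin W
  | 0, acc => .pure acc
  | R + 1, acc => (subsum add L acc).bind (sample L R)

/-- Assign random values to the first `k` variables. -/
def draw (L : List W) (R : ℕ) (z : W) : ℕ → (ℕ → W) → Coin (ℕ → W)
  | 0, v => .pure v
  | k + 1, v => (draw L R z k v).bind fun v' =>
      (sample add L R z).bind fun y => .pure (Function.update v' k y)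

theorem subsum_append (L M : List W) (acc : W) :
    subsum add (L ++ M) acc = (subsum add L acc).bind (subsum add M) := by
  induction L generalizing acc with
  | nil => rfl
  | cons l L ih => simp [subsum, Coin.bind, ih]

theorem sample_eq (L : List W) (R : ℕ) (acc : W) :
    sample add L R acc = subsum add (List.replicate R L).flatten acc := by
  induction R generalizing acc with
  | zero => rfl
  | succ R ih =>
    rw [List.replicate_succ, List.flatten_cons, subsum_append, sample]
    congr 1; funext a; exact ih a

theorem sample_succ (L : List W) (R : ℕ) (acc : W) :
    sample add L (R + 1) acc = (sample add L R acc).bind (subsum add L) := by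
  rw [sample_eq, sample_eq, ← subsum_append, List.replicate_succ', List.flatten_append]
  simp

theorem self_mem_support_subsum (L : List W) (acc : W) : acc ∈ (subsum add L acc).support := by
  induction L generalizing acc with
  | nil => rfl
  | cons l L ih => exact Or.inl (ih acc)

theorem add_mem_support_subsum {L : List W} {l : W} (hl : l ∈ L) (acc : W) :
    add acc l ∈ (subsum add L acc).support := by
  induction L generalizing acc with
  | nil => simp at hl
  | cons l' L ih =>
    rcases List.mem_cons.1 hl with rfl | hl
    · exact Or.inr (self_mem_support_subsum add L _)
    · exact Or.inl (ih hl acc)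

theorem E_subsum_concat (M : List W) (l acc : W) (g : W → ℝ) :
    (subsum add (M ++ [l]) acc).E g =
      ((subsum add M acc).E g + (subsum add M acc).E fun z => g (add z l)) / 2 := by
  induction M generalizing acc with
  | nil => simp [subsum, E]
  | cons m M ih => simp only [List.cons_append, subsum, E, ih]; ring

theorem mem_support_subsum_concat {M : List W} {l acc z : W} :
    z ∈ (subsum add (M ++ [l]) acc).support ↔
      z ∈ (subsum add M acc).support ∨ ∃ y ∈ (subsum add M acc).support, z = add y l := by
  induction M generalizing acc with
  | nil => simp [subsum, support, or_comm]
  | cons m M ih =>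
    simp only [List.cons_append, subsum, support, Set.mem_union, ih]
    constructor
    · rintro ((h | ⟨y, hy, rfl⟩) | (h | ⟨y, hy, rfl⟩))
      · exact Or.inl (Or.inl h)
      · exact Or.inr ⟨y, Or.inl hy, rfl⟩
      · exact Or.inl (Or.inr h)
      · exact Or.inr ⟨y, Or.inr hy, rfl⟩
    · rintro ((h | h) | ⟨y, hy | hy, rfl⟩)
      · exact Or.inl (Or.inl h)
      · exact Or.inr (Or.inl h)
      · exact Or.inl (Or.inr ⟨y, hy, rfl⟩)
      · exact Or.inr (Or.inr ⟨y, hy, rfl⟩)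

variable {G : Type v} [Group G] {add} {ρ : W → G}

/-- A random subproduct avoids a given proper subgroup with probability at least `1/2`. -/
theorem E_subsum_mem_le (hρ : ∀ a b, ρ (add a b) = ρ a * ρ b) (K : Subgroup G) {M : List W}
    (hM : ∃ l ∈ M, ρ l ∉ K) (acc : W) :
    (subsum add M acc).E (fun z => ind (ρ z ∈ K)) ≤ 1 / 2 := by
  induction M using List.reverseRecOn generalizing acc with
  | nil => simp at hM
  | append_singleton M l ih =>
    rw [E_subsum_concat]
    -- Condition on whether the last element `l` is taken. If `l` is in `K`, it changes nothing;
    -- otherwise `z` and `z * l` are not both in `K`.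
    by_cases hl : ρ l ∈ K
    · have hM' : ∃ l ∈ M, ρ l ∉ K := by
        obtain ⟨m, hm, hmK⟩ := hM
        rcases List.mem_append.1 hm with hm | hm
        · exact ⟨m, hm, hmK⟩
        · rw [List.mem_singleton.1 hm] at hmK; exact absurd hl hmK
      have h1 := ih hM' acc
      have h2 : ((subsum add M acc).E fun z => ind (ρ (add z l) ∈ K)) ≤ 1 / 2 :=
        (E_mono fun z _ => ind_mono fun h => by
          rwa [hρ, Subgroup.mul_mem_cancel_right _ hl] at h).trans h1
      linarith
    · have : ((subsum add M acc).E fun z => ind (ρ (add z l) ∈ K)) ≤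
          (subsum add M acc).E fun z => 1 + (-1) * ind (ρ z ∈ K) := by
        refine E_mono fun z _ => ?_
        by_cases hz : ρ z ∈ K
        · rw [ind_true hz, ind_false]
          · norm_num
          · rw [hρ, Subgroup.mul_mem_cancel_left _ hz]; exact hl
        · rw [ind_false hz]; have := ind_le_one (ρ (add z l) ∈ K); linarith
      rw [E_affine] at this
      linarith

theorem E_sample_mem_le (hρ : ∀ a b, ρ (add a b) = ρ a * ρ b) (K : Subgroup G) {L : List W}
    (hL : ∃ l ∈ L, ρ l ∉ K) {R : ℕ} (hR : 0 < R) (acc : W) :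
    (sample add L R acc).E (fun z => ind (ρ z ∈ K)) ≤ 1 / 2 := by
  rw [sample_eq]
  refine E_subsum_mem_le hρ K ?_ acc
  obtain ⟨l, hl, hK⟩ := hL
  exact ⟨l, List.mem_flatten.2 ⟨L, List.mem_replicate.2 ⟨hR.ne', rfl⟩, hl⟩, hK⟩

/-- A Schwartz–Zippel lemma for random subproducts. -/
theorem E_subsum_eq_one_le (hρ : ∀ a b, ρ (add a b) = ρ a * ρ b) {F : ℕ → Subgroup G}
    {r i : ℕ} (hr : F (i + r) = ⊥) {f : G → G} (hf : ∀ n, IsPoly F n i f)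
    {M : List W} {acc : W} (hM : ∃ z ∈ (subsum add M acc).support, f (ρ z) ≠ 1) :
    (subsum add M acc).E (fun z => ind (f (ρ z) = 1)) ≤ 1 - (1 / 2) ^ r := by
  induction M using List.reverseRecOn generalizing r i f with
  | nil =>
    obtain ⟨z, hz, hfz⟩ := hM
    cases hz
    simp only [subsum, E]
    rw [ind_false hfz]
    have : (1 / 2 : ℝ) ^ r ≤ 1 := pow_le_one₀ (by norm_num) (by norm_num)
    linarith
  | append_singleton M l ih =>
    rw [E_subsum_concat]
    have hsh : ∀ n, IsPoly F n i fun x => f (x * ρ l) := fun n => (hf n).shift _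
    have hd : ∀ n, IsPoly F n (i + 1) (rdiff (ρ l) f) := fun n => (hf (n + 1)).2 _
    -- For `r = 0` the map takes values in the trivial group, contrary to `hM`.
    have hpos : ∃ r', r = r' + 1 := by
      cases r with
      | zero =>
        obtain ⟨z, hz, hfz⟩ := hM
        have := (hf 0).mem (ρ z)
        rw [add_zero] at hr
        rw [hr] at this
        exact absurd (Subgroup.mem_bot.1 this) hfz
      | succ r' => exact ⟨r', rfl⟩
    obtain ⟨r', rfl⟩ := hpos
    have hr' : F (i + 1 + r') = ⊥ := by rw [← hr]; congr 1; omega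
    -- If `f` vanishes on one of the two halves (`l` omitted or taken), then on the other half it
    -- is, up to inversion, the derivative in direction `ρ l`. That has one level less to go, and
    -- averaging its bound with 1 costs the one factor 1/2.
    by_cases h0 : ∀ z ∈ (subsum add M acc).support, f (ρ z) = 1
    · have heq : ∀ z ∈ (subsum add M acc).support, f (ρ (add z l)) = rdiff (ρ l) f (ρ z) := by
        intro z hz; simp [rdiff, hρ, h0 z hz]
      have h1 := ih hr' hd (by
        obtain ⟨z, hz, hfz⟩ := hM
        rcases (mem_support_subsum_concat add).1 hz with hz | ⟨y, hy, rfl⟩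
        · exact absurd (h0 z hz) hfz
        · exact ⟨y, hy, by rwa [← heq y hy]⟩)
      have h2 : ((subsum add M acc).E fun z => ind (f (ρ (add z l)) = 1)) ≤
          (subsum add M acc).E fun z => ind (rdiff (ρ l) f (ρ z) = 1) :=
        E_mono fun z hz => by rw [heq z hz]
      have h3 : ((subsum add M acc).E fun z => ind (f (ρ z) = 1)) ≤ 1 :=
        E_le fun z _ => ind_le_one _
      rw [pow_succ]
      linarith
    · by_cases h1 : ∀ z ∈ (subsum add M acc).support, f (ρ (add z l)) = 1
      · have heq : ∀ z ∈ (subsum add M acc).support, f (ρ z) = (rdiff (ρ l) f (ρ z))⁻¹ := by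
          intro z hz
          have := h1 z hz
          rw [hρ] at this
          simp [rdiff, this]
        push Not at h0
        have h2 := ih hr' hd (by
          obtain ⟨y, hy, hfy⟩ := h0
          refine ⟨y, hy, ?_⟩
          rwa [heq y hy, ne_eq, inv_eq_one] at hfy)
        have h2 : ((subsum add M acc).E fun z => ind (f (ρ z) = 1)) ≤
            (subsum add M acc).E fun z => ind (rdiff (ρ l) f (ρ z) = 1) :=
          E_mono fun z hz => by rw [heq z hz, inv_eq_one]
        have h3 : ((subsum add M acc).E fun z => ind (f (ρ (add z l)) = 1)) ≤ 1 :=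
          E_le fun z _ => ind_le_one _
        rw [pow_succ]
        linarith
      -- If `f` vanishes on neither half, the bound for `r` holds on both, hence for the average.
      · push Not at h0 h1
        have h2 := ih hr hf h0
        have h3 := ih (f := fun x => f (x * ρ l)) hr hsh (by simpa only [hρ] using h1)
        simp only [hρ]
        linarith

/-- A polynomial map that vanishes on short products of generators vanishes. -/
theorem eq_one_of_sample (hρ : ∀ a b, ρ (add a b) = ρ a * ρ b) {F : ℕ → Subgroup G}
    {L : List W} (hL : Subgroup.closure {h | ∃ w ∈ L, ρ w = h} = ⊤) {z₀ : W} (hz₀ : ρ z₀ = 1)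
    {r i : ℕ} (hr : F (i + r) = ⊥) {f : G → G} (hf : ∀ n, IsPoly F n i f)
    (h : ∀ z ∈ (sample add L r z₀).support, f (ρ z) = 1) (x : G) : f x = 1 := by
  induction r generalizing i f x with
  | zero =>
    have := (hf 0).mem x
    rwa [← add_zero i, hr, Subgroup.mem_bot] at this
  | succ r ih =>
    have hsupp : ∀ z ∈ (sample add L r z₀).support, z ∈ (sample add L (r + 1) z₀).support ∧
        ∀ l ∈ L, add z l ∈ (sample add L (r + 1) z₀).support := fun z hz => by
      rw [sample_succ]
      exact ⟨mem_support_bind hz (self_mem_support_subsum add L z),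
        fun l hl => mem_support_bind hz (add_mem_support_subsum add hl z)⟩
    have hz : z₀ ∈ (sample add L (r + 1) z₀).support := by
      rw [sample_eq]; exact self_mem_support_subsum add _ _
    -- The derivative along a generator vanishes on products from `r` copies of `L`, because one
    -- more copy can supply the generator. By induction it vanishes identically, so `f` is invariant
    -- under right translation by generators and is constant.
    have hper : ∀ l ∈ L, ∀ y, f (y * ρ l) = f y := by
      intro l hl y
      have := ih (i := i + 1) (f := rdiff (ρ l) f) (by rw [← hr]; congr 1; omega)
        (fun n => (hf (n + 1)).2 _) (fun z hz => by
          have h1 := h _ (hsupp z hz).1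
          have h2 := h _ ((hsupp z hz).2 l hl)
          rw [hρ] at h2
          simp [rdiff, h1, h2]) y
      rw [rdiff, inv_mul_eq_one] at this
      exact this.symm
    have hall : ∀ y, f (y * x) = f y := by
      have hx : x ∈ Subgroup.closure {h | ∃ w ∈ L, ρ w = h} := hL ▸ Subgroup.mem_top x
      induction hx using Subgroup.closure_induction with
      | mem g hg =>
        obtain ⟨l, hl, rfl⟩ := hg
        exact hper l hl
      | one => simp
      | mul a b _ _ ha hb => intro y; rw [← mul_assoc, hb, ha]
      | inv a _ ha => intro y; rw [← ha, inv_mul_cancel_right]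
    have := hall (ρ z₀)
    rw [h _ hz, hz₀, one_mul] at this
    exact this

/-- A nontrivial polynomial map does not vanish at a random element with probability bounded away
from zero. -/
theorem E_sample_eq_one_le (hρ : ∀ a b, ρ (add a b) = ρ a * ρ b) {F : ℕ → Subgroup G}
    {L : List W} (hL : Subgroup.closure {h | ∃ w ∈ L, ρ w = h} = ⊤)
    {z₀ : W} (hz₀ : ρ z₀ = 1) {r : ℕ} (hr : F r = ⊥) {f : G → G}
    (hf : ∀ n, IsPoly F n 0 f) {x : G} (hx : f x ≠ 1) :
    (sample add L r z₀).E (fun z => ind (f (ρ z) = 1)) ≤ 1 - (1 / 2) ^ r := by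
  have hr' : F (0 + r) = ⊥ := by rwa [zero_add]
  have : ∃ z ∈ (sample add L r z₀).support, f (ρ z) ≠ 1 := by
    by_contra! hc
    exact hx (eq_one_of_sample hρ hL hz₀ hr' hf hc x)
  rw [sample_eq] at this ⊢
  exact E_subsum_eq_one_le hρ hr' hf this

variable (add) in
/-- If `S 0` does not hold, and if from `¬ S j` one gets to `S (j + 1)` with probability at most
`1 - δ` by drawing another random element, then `S k` holds with probability at most `1 - δ ^ k`. -/
theorem E_draw_le {L : List W} {R : ℕ} {z : W} {S : ℕ → (ℕ → W) → Prop} {δ : ℝ} (hδ : 0 ≤ δ)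
    {v : ℕ → W} (h0 : ¬ S 0 v) (k : ℕ) (hS : ∀ j < k, ∀ v, ¬ S j v →
      (sample add L R z).E (fun y => ind (S (j + 1) (Function.update v j y))) ≤ 1 - δ) :
    (draw add L R z k v).E (fun v' => ind (S k v')) ≤ 1 - δ ^ k := by
  induction k with
  | zero => simp [draw, E, ind_false h0]
  | succ k ih =>
    have ih := ih fun j hj => hS j (by omega)
    simp only [draw, E_bind, E]
    -- With `p` the probability of `S k`, that of `S (k + 1)` is at most `(1 - δ) + δ * p`;
    -- inserting `p ≤ 1 - δ ^ k` gives `1 - δ ^ (k + 1)`.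
    have : ∀ v' ∈ (draw add L R z k v).support,
        (sample add L R z).E (fun y => ind (S (k + 1) (Function.update v' k y))) ≤
          (1 - δ) + δ * ind (S k v') := by
      intro v' _
      by_cases hv : S k v'
      · rw [ind_true hv]
        exact (E_le fun _ _ => ind_le_one _).trans (by linarith)
      · rw [ind_false hv]
        exact (hS k (by omega) v' hv).trans (by linarith)
    refine (E_mono this).trans ?_
    rw [E_affine, pow_succ]
    nlinarith

end Sample

open FirstOrder Language Coin

open scoped commutatorElement

/-! ### Expanded groups in multiplicative notation -/

/-- The additive group of an expanded group, written multiplicatively. -/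
abbrev IsExpandedGroup.group {Ω : FirstOrder.Language.{u, u'}} {H : Type v}
    [(expLang Ω).Structure H] (h : IsExpandedGroup Ω H) : Group H :=
  letI : Mul H := ⟨addOp Ω⟩
  letI : Inv H := ⟨negOp Ω⟩
  letI : One H := ⟨zeroOp Ω H⟩
  Group.ofLeftAxioms h.add_assoc h.zero_add h.neg_add

/-! ### The nilpotency law as an identity, and a uniform bound for the class -/

section Terms

variable (Ω : FirstOrder.Language.{u, u'})

/-- The sum of two terms. -/
def addTerm (s t : (expLang Ω).Term ℕ) : (expLang Ω).Term ℕ :=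
  .func (l := 2) (Sum.inl GroupSymbol.add) ![s, t]

/-- The negative of a term. -/
def negTerm (s : (expLang Ω).Term ℕ) : (expLang Ω).Term ℕ :=
  .func (l := 1) (Sum.inl GroupSymbol.neg) ![s]

/-- The term `0`. -/
def zeroTerm : (expLang Ω).Term ℕ :=
  .func (l := 0) (Sum.inl GroupSymbol.zero) ![]

/-- The additive commutator of two terms. -/
def commTerm (s t : (expLang Ω).Term ℕ) : (expLang Ω).Term ℕ :=
  addTerm Ω (addTerm Ω (addTerm Ω s t) (negTerm Ω s)) (negTerm Ω t)

/-- The left-normed commutator of `x_0, …, x_d`. -/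
def nilTerm : ℕ → (expLang Ω).Term ℕ
  | 0 => .var 0
  | d + 1 => commTerm Ω (nilTerm d) (.var (d + 1))

theorem realize_congr {L : FirstOrder.Language.{u, u'}} {M : Type v} [L.Structure M]
    (t : L.Term ℕ) {v w : ℕ → M} (h : ∀ i ∈ t.varFinset, v i = w i) :
    t.realize v = t.realize w := by
  induction t with
  | var i => exact h i (by simp [Term.varFinset])
  | func f ts ih =>
    simp only [Term.realize]
    congr 1; funext i
    exact ih i fun j hj => h j (by simp only [Term.varFinset, Finset.mem_biUnion]; exact ⟨i, Finset.mem_univ i, hj⟩)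

variable {H : Type v} [(expLang Ω).Structure H]

theorem realize_addTerm (s t : (expLang Ω).Term ℕ) (v : ℕ → H) :
    (addTerm Ω s t).realize v = addOp Ω (s.realize v) (t.realize v) := by
  simp only [addTerm, Term.realize, addOp]
  congr 1; funext i; fin_cases i <;> rfl

theorem realize_negTerm (s : (expLang Ω).Term ℕ) (v : ℕ → H) :
    (negTerm Ω s).realize v = negOp Ω (s.realize v) := by
  simp only [negTerm, Term.realize, negOp]
  congr 1; funext i; fin_cases i; rfl

theorem realize_zeroTerm (v : ℕ → H) : (zeroTerm Ω).realize v = zeroOp Ω H := by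
  simp only [zeroTerm, Term.realize, zeroOp]
  congr 1; funext i; exact i.elim0

theorem lt_of_mem_nilTerm {d i : ℕ} (h : i ∈ (nilTerm Ω d).varFinset) : i < d + 1 := by
  induction d generalizing i with
  | zero => simp [nilTerm, Term.varFinset] at h; omega
  | succ d ih =>
    simp [nilTerm, commTerm, addTerm, negTerm, Term.varFinset, Fin.exists_fin_two] at h
    rcases h with ((h | h) | h) | h
    all_goals first | (have := ih h; omega) | omega

theorem exists_nilTerm_of_hasNilpotentAddGroup (h : HasNilpotentAddGroup Ω H) :
    ∃ d, Satisfies (expLang Ω) H (nilTerm Ω d, zeroTerm Ω) := by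
  obtain ⟨h, hn⟩ := h
  let := h.addGroup
  obtain ⟨d, hd⟩ := AddSubgroup.nilpotent_iff_lowerCentralSeries.1 hn
  refine ⟨d, fun a => ?_⟩
  have key : ∀ j, (nilTerm Ω j).realize a ∈ (⊤ : AddSubgroup H).lowerCentralSeries j := by
    intro j
    induction j with
    | zero => exact AddSubgroup.mem_top _
    | succ j ih =>
      rw [AddSubgroup.lowerCentralSeries_succ]
      have := AddSubgroup.addCommutator_mem_addCommutator ih
        (AddSubgroup.mem_top (a (j + 1)))
      convert this using 1
      simp only [nilTerm, commTerm, realize_addTerm, realize_negTerm, Term.realize_var]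
      rw [addCommutatorElement_def]
      rfl
  have := key d
  rw [hd, AddSubgroup.mem_bot] at this
  rw [this, realize_zeroTerm]
  rfl

end Terms

/-- The product of a family of algebras. -/
@[reducible] def piStructure {L : FirstOrder.Language.{u, u'}} {I : Type} (H : I → Type v)
    [∀ i, L.Structure (H i)] : L.Structure (∀ i, H i) where
  funMap f x := fun i => FirstOrder.Language.Structure.funMap f fun j => x j i
  RelMap _ _ := False

theorem realize_pi {L : FirstOrder.Language.{u, u'}} {I : Type} (H : I → Type v)
    [∀ i, L.Structure (H i)] (t : L.Term ℕ) (v : ℕ → ∀ i, H i) (i : I) :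
    (letI := piStructure (L := L) H; t.realize v) i = t.realize fun j => v j i := by
  induction t with
  | var k => rfl
  | func f ts ih =>
    simp only [Term.realize]
    change FirstOrder.Language.Structure.funMap f _ = _
    congr 1; funext j; exact ih j

/-- In a finitely based variety of algebras with nilpotent additive groups, the nilpotency class
is bounded. -/
theorem exists_nilTerm_of_variety {Ω : FirstOrder.Language.{u, u'}}
    {V : AlgClass.{u, u', v} (expLang Ω)} (hV : IsFinitelyBasedVariety V)
    (hnil : ∀ (H : Type v) [(expLang Ω).Structure H], V H → HasNilpotentAddGroup Ω H) :
    ∃ d, ∀ (H : Type v) [(expLang Ω).Structure H], V H →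
      Satisfies (expLang Ω) H (nilTerm Ω d, zeroTerm Ω) := by
  by_contra! hc
  -- If no class bound works for the whole variety, the product of counterexamples for all `d` is in
  -- the variety. It is nilpotent, so it satisfies the law for some `d`, which the factor `H d`
  -- violates.
  choose H hH hVH hns using hc
  obtain ⟨B, -, hB⟩ := hV
  let := piStructure (L := expLang Ω) H
  have hP : V (∀ d, H d) := by
    refine (hB _).2 fun e he a => ?_
    funext d
    rw [realize_pi, realize_pi]
    exact (hB (H d)).1 (hVH d) e he _
  obtain ⟨d, hd⟩ := exists_nilTerm_of_hasNilpotentAddGroup Ω (hnil _ hP)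
  refine hns d fun a => ?_
  have hz : ∀ e, Nonempty (H e) := fun e => ⟨zeroOp Ω (H e)⟩
  classical
  -- The given assignment is placed in coordinate `d`; the values in the other coordinates do not
  -- matter.
  have := congr_fun (hd fun j => Function.update (fun e => (hz e).some) d (a j)) d
  simpa [realize_pi] using this

/-- The group operations are those of the expanded group. -/
structure IsGroupOf (Ω : FirstOrder.Language.{u, u'}) (H : Type v) [(expLang Ω).Structure H]
    [Group H] : Prop where
  mul : ∀ a b : H, addOp Ω a b = a * b
  inv : ∀ a : H, negOp Ω a = a⁻¹
  one : zeroOp Ω H = 1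

/-! ### Random evaluation of terms, commutators and operations -/

section Group

variable {Ω : FirstOrder.Language.{u, u'}} {H : Type v} [(expLang Ω).Structure H] [Group H]

/-- Left-normed commutators. -/
def leftComm (v : ℕ → H) : ℕ → H
  | 0 => v 0
  | d + 1 => ⁅leftComm v d, v (d + 1)⁆

theorem leftComm_congr {v w : ℕ → H} {d : ℕ} (h : ∀ i ≤ d, v i = w i) :
    leftComm v d = leftComm w d := by
  induction d with
  | zero => exact h 0 le_rfl
  | succ d ih => rw [leftComm, leftComm, ih fun i hi => h i (by omega), h _ le_rfl]

theorem realize_nilTerm (hG : IsGroupOf Ω H) (v : ℕ → H) (d : ℕ) :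
    (nilTerm Ω d).realize v = leftComm v d := by
  induction d with
  | zero => rfl
  | succ d ih =>
    simp only [nilTerm, commTerm, realize_addTerm, realize_negTerm, ih, Term.realize_var, hG.mul,
      hG.inv, leftComm, commutatorElement_def]

/-- A bound for the degree of the polynomial map induced by a term. -/
def deg (d : ℕ) : (expLang Ω).Term ℕ → ℕ
  | .var _ => 1
  | .func (l := k) _ ts => (k * d + 1) * (∑ i, deg d (ts i) + 1)

theorem deg_pos (d : ℕ) (t : (expLang Ω).Term ℕ) : 0 < deg d t := by
  cases t with
  | var i => exact Nat.one_pos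
  | func f ts => rw [deg]; positivity

/-- Terms are polynomial maps in each variable. -/
theorem isPoly_realize (hG : IsGroupOf Ω H) (hH : IsDistributive Ω H) {d : ℕ}
    (hd : (⊤ : Subgroup H).lowerCentralSeries d = ⊥) (t : (expLang Ω).Term ℕ) (w : ℕ → H) (j : ℕ)
    (n : ℕ) :
    IsPoly (slowSeries H (deg d t)) n 0 fun x => t.realize (Function.update w j x) := by
  induction t with
  | var i =>
    have hF := isFiltration_slowSeries (G := H) (deg_pos d (.var i : (expLang Ω).Term ℕ))
    by_cases hi : i = j
    · subst hi; simpa using IsPoly.ident hF n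
    · simp only [Term.realize_var, Function.update_of_ne hi]
      exact IsPoly.const (hF.anti zero_le_one (hF.one ▸ Subgroup.mem_top _)) n
  | @func k f ts ih =>
    -- `D` is a slow factor common to all subterms. Passing to `(k * d + 1) * D` provides the `k *
    -- (d * D)` that a distributive operation needs; the further `D` keeps the factor at least `D`,
    -- as the group operations require.
    set D := ∑ i, deg d (ts i) + 1 with hD
    have hD0 : 0 < D := Nat.succ_pos _
    have hdeg : deg d (.func f ts) = (k * d + 1) * D := rfl
    have hDD : D ≤ (k * d + 1) * D := Nat.le_mul_of_pos_left _ (Nat.succ_pos _)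
    have hF := isFiltration_slowSeries (G := H) (deg_pos d (.func f ts))
    rw [hdeg] at hF ⊢
    have ih1 : ∀ i, IsPoly (slowSeries H D) n 0
        fun x => (ts i).realize (Function.update w j x) := fun i =>
      (ih i).mono fun m => slowSeries_le (deg_pos _ _)
        ((Finset.single_le_sum (f := fun i => deg d (ts i)) (fun _ _ => Nat.zero_le _)
          (Finset.mem_univ i)).trans (Nat.le_succ _)) _
    have ih2 : ∀ i, IsPoly (slowSeries H ((k * d + 1) * D)) n 0
        fun x => (ts i).realize (Function.update w j x) := fun i =>
      (ih1 i).mono fun m => slowSeries_le hD0 hDD _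
    clear_value D
    simp only [Term.realize]
    rcases f with f | ω
    · cases f with
      | add =>
        convert (ih2 0).mul hF (ih2 1) using 2 with x
        rw [← hG.mul, addOp]
        congr 1; funext i; fin_cases i <;> rfl
      | neg =>
        convert (ih2 0).inv hF using 2 with x
        rw [← hG.inv, negOp]
        congr 1; funext i; fin_cases i; rfl
      | zero =>
        convert IsPoly.const (F := slowSeries H ((0 * d + 1) * D)) (i := 0)
          (one_mem _) n using 2 with x
        rw [← hG.one, zeroOp]
        congr 1; funext i; exact i.elim0
    · have hω : ∀ (i : Fin k) (h : Fin k → H) (a b : H),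
          omegaOp Ω ω (Function.update h i (a * b)) =
          omegaOp Ω ω (Function.update h i a) * omegaOp Ω ω (Function.update h i b) :=
        fun i h a b => by rw [← hG.mul, ← hG.mul]; exact hH.distrib ω i h a b
      have := IsPoly.multilinear (n := n) hF hω
        (multilinear_slowSeries hD0 hd (by nlinarith) hω) (a := fun _ => 0) ih1
      rw [Finset.sum_const_zero] at this
      exact this

variable {W : Type} {add : W → W → W} {ρ : W → H}

theorem exists_notMem_of_closure_eq_top {L : List W}
    (hL : Subgroup.closure {h | ∃ w ∈ L, ρ w = h} = ⊤) {K : Subgroup H} {x : H} (hx : x ∉ K) :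
    ∃ l ∈ L, ρ l ∉ K := by
  by_contra! hc
  refine hx ((Subgroup.closure_le K).2 ?_ (hL ▸ Subgroup.mem_top x))
  rintro h ⟨w, hw, rfl⟩
  exact hc w hw

/-- A failing identity is detected by random elements. -/
theorem E_draw_realize_le (hρ : ∀ a b, ρ (add a b) = ρ a * ρ b) (hG : IsGroupOf Ω H)
    (hH : IsDistributive Ω H) {d : ℕ} (hd : (⊤ : Subgroup H).lowerCentralSeries d = ⊥)
    {L : List W} (hL : Subgroup.closure {h | ∃ w ∈ L, ρ w = h} = ⊤) {z : W} (hz : ρ z = 1)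
    {e : (expLang Ω).Term ℕ × (expLang Ω).Term ℕ} (he : ¬ Satisfies (expLang Ω) H e) {D m : ℕ}
    (h1 : deg d e.1 ≤ D) (h2 : deg d e.2 ≤ D)
    (hm1 : ∀ i ∈ e.1.varFinset, i < m) (hm2 : ∀ i ∈ e.2.varFinset, i < m) (v : ℕ → W) :
    (draw add L (d * D + 1) z m v).E
      (fun v => ind (e.1.realize (fun i => ρ (v i)) = e.2.realize fun i => ρ (v i))) ≤
      1 - ((1 / 2) ^ (d * D + 1)) ^ m := by
  have hD : 0 < D := (deg_pos d e.1).trans_le h1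
  -- `S j` says that the identity still holds for all completions of the first `j` chosen values. `S
  -- 0` is the identity itself; `S m` leaves no relevant freedom.
  let S : ℕ → (ℕ → W) → Prop := fun j v => ∀ w : ℕ → H, (∀ i < j, w i = ρ (v i)) →
    e.1.realize w = e.2.realize w
  refine (E_mono fun v _ => ind_mono fun h => ?_).trans
    (E_draw_le add (S := S) (by positivity) (fun h0 => he fun a => h0 a (by simp)) m ?_)
  · intro w hw
    rw [realize_congr e.1 fun i hi => hw i (hm1 i hi),
      realize_congr e.2 fun i hi => hw i (hm2 i hi)]
    exact h
  · intro j _ v hv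
    simp only [S] at hv
    push Not at hv
    obtain ⟨w, hw, hne⟩ := hv
    have hF := isFiltration_slowSeries (G := H) hD
    let f : H → H := fun x =>
      -- The quotient of the two sides as a map of variable `j`, the others being fixed by the
      -- failing completion `w`. It is nontrivial at `w j`, and its filtration is trivial at level
      -- `d * D + 1`, the number of random subproducts used.
      (e.1.realize (Function.update w j x))⁻¹ * e.2.realize (Function.update w j x)
    have hf : ∀ n, IsPoly (slowSeries H D) n 0 f := fun n =>
      (((isPoly_realize hG hH hd e.1 w j n).mono fun m =>
        slowSeries_le (deg_pos _ _) h1 _).inv hF).mul hF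
        ((isPoly_realize hG hH hd e.2 w j n).mono fun m => slowSeries_le (deg_pos _ _) h2 _)
    refine (E_mono fun y _ => ind_mono fun h => ?_).trans
      (E_sample_eq_one_le hρ hL hz (slowSeries_eq_bot hD hd (Nat.lt_succ_self _)) hf
        (x := w j) ?_)
    · simp only [f, inv_mul_eq_one]
      refine h _ fun i hi => ?_
      by_cases hij : i = j
      · subst hij; simp
      · simp only [Function.update_of_ne hij]
        exact hw i (by omega)
    · simpa only [f, Function.update_eq_self, ne_eq, inv_mul_eq_one] using hne

/-- A high nilpotency class is detected by random elements. -/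
theorem E_draw_leftComm_le (hρ : ∀ a b, ρ (add a b) = ρ a * ρ b) {d : ℕ}
    (hd : (⊤ : Subgroup H).lowerCentralSeries d ≠ ⊥)
    {L : List W} (hL : Subgroup.closure {h | ∃ w ∈ L, ρ w = h} = ⊤) (z : W) {R m : ℕ}
    (hR : 0 < R) (hm : d < m) (v : ℕ → W) :
    (draw add L R z m v).E (fun v => ind (leftComm (fun i => ρ (v i)) d = 1)) ≤
      1 - (1 / 2) ^ m := by
  rw [ne_eq, Subgroup.lowerCentralSeries_eq_bot_iff_upperCentralSeries_eq_top] at hd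
  -- `S j` is the bad event that after `j` choices the partial commutator has dropped into the `(d -
  -- (j - 1))`-th center. The clause `j ≠ 0` makes `S 0` false; `min` freezes the commutator once
  -- its `d + 1` entries are chosen.
  let S : ℕ → (ℕ → W) → Prop := fun j v => j ≠ 0 ∧
    leftComm (fun i => ρ (v i)) (min (j - 1) d) ∈ Subgroup.upperCentralSeries H (d - (j - 1))
  refine (E_mono fun v _ => ind_mono fun h => ?_).trans
    (E_draw_le add (S := S) (by norm_num) (fun h0 => h0.1 rfl) m ?_)
  · refine ⟨by omega, ?_⟩
    rw [min_eq_right (by omega), h]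
    exact one_mem _
  · intro j _ v hv
    rw [show (1 : ℝ) - 1 / 2 = 1 / 2 by norm_num]
    cases j with
    | zero =>
      obtain ⟨x, hx⟩ : ∃ x, x ∉ Subgroup.upperCentralSeries H d := by
        by_contra! hc
        exact hd ((Subgroup.eq_top_iff' _).2 hc)
      refine (E_mono fun y _ => ind_mono fun h => ?_).trans
        (E_sample_mem_le hρ (Subgroup.upperCentralSeries H d)
          (exists_notMem_of_closure_eq_top hL hx) hR z)
      simpa [S, leftComm] using h
    | succ j =>
      have hv : leftComm (fun i => ρ (v i)) (min j d) ∉ Subgroup.upperCentralSeries H (d - j) :=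
        fun h => hv ⟨by omega, h⟩
      by_cases hj : j < d
      · rw [min_eq_left hj.le, show d - j = (d - (j + 1)) + 1 by omega,
          Subgroup.mem_upperCentralSeries_succ_iff] at hv
        push Not at hv
        obtain ⟨x, hx⟩ := hv
        let N := Subgroup.upperCentralSeries H (d - (j + 1))
        let c := leftComm (fun i => ρ (v i)) j
        -- The `y` with `⁅c, y⁆` in `N` form the preimage of a centralizer in the quotient by `N`,
        -- hence a subgroup. It is proper because `c` is not in the next term of the upper central
        -- series.
        let K : Subgroup H :=
          (Subgroup.centralizer {(QuotientGroup.mk' N) c}).comap (QuotientGroup.mk' N)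
        have hK : ∀ y, y ∈ K ↔ ⁅c, y⁆ ∈ N := by
          intro y
          rw [Subgroup.mem_comap, Subgroup.mem_centralizer_singleton_iff,
            ← QuotientGroup.eq_one_iff, ← QuotientGroup.mk'_apply, map_commutatorElement,
            commutatorElement_eq_one_iff_mul_comm, eq_comm]
        refine (E_mono fun y _ => ind_mono fun h => ?_).trans
          (E_sample_mem_le hρ K (exists_notMem_of_closure_eq_top hL (x := x) ?_) hR z)
        · have h2 := h.2
          rw [hK]
          rw [show j + 1 + 1 - 1 = j + 1 from rfl, min_eq_left hj] at h2
          simp only [leftComm, Function.update_self] at h2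
          have hc : leftComm (fun i => ρ (Function.update v (j + 1) y i)) j = c :=
            leftComm_congr fun i hi => by rw [Function.update_of_ne (by omega)]
          rwa [hc] at h2
        · rw [hK]
          simpa [commutatorElement_def] using hx
      -- For `j ≥ d` all entries are chosen, so a further choice leaves the good state unchanged.
      · refine E_le fun y _ => ?_
        rw [ind_false]
        · norm_num
        · rintro ⟨-, h⟩
          apply hv
          rw [show j + 1 + 1 - 1 = j + 1 from rfl, min_eq_right (by omega),
            show d - (j + 1) = d - j by omega] at h
          rw [min_eq_right (by omega)]
          convert h using 1
          refine leftComm_congr fun i hi => ?_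
          rw [Function.update_of_ne (by omega)]

/-- A random value of an operation under which a subgroup is not closed is outside of this
subgroup with probability bounded away from zero. -/
theorem E_draw_omega_le (hρ : ∀ a b, ρ (add a b) = ρ a * ρ b) (hG : IsGroupOf Ω H)
    (hH : IsDistributive Ω H) {k : ℕ} (ω : Ω.Functions k) {L : List W} {A : Subgroup H}
    (hA : Subgroup.closure {h | ∃ w ∈ L, ρ w = h} = A) {h : Fin k → H} (hh : ∀ i, h i ∈ A)
    (hω : omegaOp Ω ω h ∉ A) (z : W) {R : ℕ} (hR : 0 < R) (v : ℕ → W) :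
    (draw add L R z k v).E (fun v => ind (omegaOp Ω ω (fun i => ρ (v i)) ∈ A)) ≤
      1 - (1 / 2) ^ k := by
  -- `S j` is the bad event that, with the first `j` arguments fixed as chosen, no completion by
  -- elements of `A` leads outside of `A`.
  let S : ℕ → (ℕ → W) → Prop := fun j v => ∀ w : Fin k → H, (∀ i : Fin k, j ≤ (i : ℕ) → w i ∈ A) →
    (∀ i : Fin k, (i : ℕ) < j → w i = ρ (v i)) → omegaOp Ω ω w ∈ A
  refine (E_mono fun v _ => ind_mono fun h => ?_).trans
    (E_draw_le add (S := S) (by norm_num) (fun h0 => hω (h0 h (fun i _ => hh i) (by simp))) k ?_)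
  · intro w _ hw
    have : w = fun i : Fin k => ρ (v i) := funext fun i => hw i i.2
    rwa [this]
  · intro j hj v hv
    rw [show (1 : ℝ) - 1 / 2 = 1 / 2 by norm_num]
    simp only [S] at hv
    push Not at hv
    obtain ⟨w, hwA, hw, hwn⟩ := hv
    let J : Fin k := ⟨j, hj⟩
    -- By distributivity the operation is a homomorphism in argument `J`. As `φ` maps some element
    -- of `A` outside of `A`, some generator is not in the preimage of `A`, and random subproducts
    -- avoid this preimage with probability at least 1/2.
    let φ : H →* H := MonoidHom.mk' (fun y => omegaOp Ω ω (Function.update w J y)) fun a b => by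
      rw [← hG.mul, ← hG.mul]; exact hH.distrib ω J w a b
    have hφ : ∀ y, φ y = omegaOp Ω ω (Function.update w J y) := fun _ => rfl
    have hex : ∃ l ∈ L, ρ l ∉ A.comap φ := by
      by_contra! hc
      have hle : A ≤ A.comap φ := by
        conv_lhs => rw [← hA]
        rw [Subgroup.closure_le]
        rintro h ⟨w, hw, rfl⟩
        exact hc w hw
      have := hle (hwA J le_rfl)
      rw [Subgroup.mem_comap, hφ, Function.update_eq_self] at this
      exact hwn this
    refine (E_mono fun y _ => ind_mono fun h => ?_).trans (E_sample_mem_le hρ _ hex hR z)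
    rw [Subgroup.mem_comap, hφ]
    refine h _ (fun i hi => ?_) fun i hi => ?_
    · have : i ≠ J := fun h => by rw [h] at hi; simp [J] at hi
      rw [Function.update_of_ne this]
      exact hwA i (by omega)
    · by_cases hij : i = J
      · subst hij; simp [J]
      · have : (i : ℕ) ≠ j := fun h => hij (Fin.ext h)
        rw [Function.update_of_ne hij, Function.update_of_ne this]
        exact hw i (by omega)

end Group

/-! ### The algorithm, as a random computation -/

namespace Coin

/-- A potential that shrinks in expectation by the factor `q` in each step shrinks geometrically. It
is applied to the index of the span and to the indicator of not having rejected yet. -/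
theorem E_iter_le {α : Type} {f : α → Coin α} {Ψ : α → ℝ} {q : ℝ} (hq : 0 ≤ q)
    (hf : ∀ a, (f a).E Ψ ≤ q * Ψ a) (n : ℕ) (a : α) : (iter f n a).E Ψ ≤ q ^ n * Ψ a := by
  induction n generalizing a with
  | zero => simp [iter, E]
  | succ n ih =>
    rw [iter, E_bind]
    refine (E_mono fun a' _ => ih a').trans ?_
    have := E_affine (f a) 0 (q ^ n) Ψ
    simp only [zero_add] at this
    rw [this, pow_succ, mul_assoc]
    exact mul_le_mul_of_nonneg_left (hf a) (by positivity)

theorem E_iter_eq {α : Type} {f : α → Coin α} {Ψ : α → ℝ} (hf : ∀ a, (f a).E Ψ = Ψ a)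
    (n : ℕ) (a : α) : (iter f n a).E Ψ = Ψ a := by
  induction n generalizing a with
  | zero => rfl
  | succ n ih =>
    rw [iter, E_bind]
    simp only [ih, hf]

end Coin

section Algorithm

variable {Ω : FirstOrder.Language.{u, u'}} {W : Type} [(expLang Ω).Structure W]

/-- Assign random sums of elements of `L` to the first `k` variables. -/
def drawSums (Ω : FirstOrder.Language.{u, u'}) {W : Type} [(expLang Ω).Structure W] (L : List W)
    (R k : ℕ) : Coin (ℕ → W) :=
  draw (addOp Ω) L R (zeroOp Ω W) k fun _ => zeroOp Ω W

/-- For each operation symbol in the list, put a random value of this operation on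
`X ++ s` in front of `X`. -/
def grow (s : List W) (R : ℕ) : List (Σ k, Ω.Functions k) → List W → Coin (List W)
  | [], X => .pure X
  | ω :: l, X => (drawSums Ω (X ++ s) R ω.1).bind fun v =>
      grow s R l (omegaOp Ω ω.2 (fun i => v i) :: X)

/-- Do all identities hold for the assignment `v`? -/
def passes (ids : List ((expLang Ω).Term ℕ × (expLang Ω).Term ℕ)) (eqv : W → W → Bool)
    (v : ℕ → W) (ok : Bool) : Bool :=
  ids.foldl (fun ok e => ok && eqv (e.1.realize v) (e.2.realize v)) ok

/-- Check all identities for a random assignment of the variables `x_0, …, x_{m - 1}`. -/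
def check (ids : List ((expLang Ω).Term ℕ × (expLang Ω).Term ℕ)) (eqv : W → W → Bool)
    (L : List W) (R m : ℕ) (ok : Bool) : Coin Bool :=
  (drawSums Ω L R m).bind fun v => .pure (passes ids eqv v ok)

/-- The algorithm: enlarge the generating system `s` to a generating system of the additive group,
then check the identities for random assignments. -/
def testMember (l : List (Σ k, Ω.Functions k))
    (ids : List ((expLang Ω).Term ℕ × (expLang Ω).Term ℕ)) (R m M₁ M₂ n : ℕ)
    (eqv : W → W → Bool) (s : List W) : Coin Bool :=
  (iter (iter (grow s R l) M₁) n []).bind fun X =>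
    iter (iter (check ids eqv (X ++ s) R m) M₂) n true

theorem passes_eq (ids : List ((expLang Ω).Term ℕ × (expLang Ω).Term ℕ)) (eqv : W → W → Bool)
    (v : ℕ → W) (ok : Bool) : passes ids eqv v ok = true ↔
      ok = true ∧ ∀ e ∈ ids, eqv (e.1.realize v) (e.2.realize v) = true := by
  induction ids generalizing ok with
  | nil => simp [passes]
  | cons e ids ih =>
    have : passes (e :: ids) eqv v ok =
      passes ids eqv v (ok && eqv (e.1.realize v) (e.2.realize v)) := rfl
    rw [this, ih]
    simp [and_assoc]

/-! ### Analysis of the algorithm: decreasing index and error probability -/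

variable {H : Type v} [(expLang Ω).Structure H] {ρ : W → H}

theorem map_realize (hρ : ∀ {k : ℕ} (f : (expLang Ω).Functions k) (x : Fin k → W),
    ρ (FirstOrder.Language.Structure.funMap f x) =
      FirstOrder.Language.Structure.funMap f fun i => ρ (x i))
    (t : (expLang Ω).Term ℕ) (v : ℕ → W) : ρ (t.realize v) = t.realize fun i => ρ (v i) := by
  induction t with
  | var i => rfl
  | func f ts ih => simp only [Term.realize, hρ, ih]

variable [Group H]

theorem map_addOp (hρ : ∀ {k : ℕ} (f : (expLang Ω).Functions k) (x : Fin k → W),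
    ρ (FirstOrder.Language.Structure.funMap f x) =
      FirstOrder.Language.Structure.funMap f fun i => ρ (x i))
    (hG : IsGroupOf Ω H) (a b : W) : ρ (addOp Ω a b) = ρ a * ρ b := by
  rw [← hG.mul]
  refine (hρ _ _).trans ?_
  rw [addOp]
  congr 1; funext i; fin_cases i <;> rfl

theorem map_zeroOp (hρ : ∀ {k : ℕ} (f : (expLang Ω).Functions k) (x : Fin k → W),
    ρ (FirstOrder.Language.Structure.funMap f x) =
      FirstOrder.Language.Structure.funMap f fun i => ρ (x i))
    (hG : IsGroupOf Ω H) : ρ (zeroOp Ω W) = 1 := by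
  rw [← hG.one]
  refine (hρ _ _).trans ?_
  rw [zeroOp]
  congr 1; funext i; exact i.elim0

/-- The index of a proper subgroup, and `0` for the whole group. -/
noncomputable def indexPot (A : Subgroup H) : ℝ := open Classical in if A = ⊤ then 0 else A.index

/-- The subgroup generated by the elements represented by `L`. -/
def span (ρ : W → H) (L : List W) : Subgroup H := Subgroup.closure {h | ∃ w ∈ L, ρ w = h}

theorem indexPot_nonneg (A : Subgroup H) : 0 ≤ indexPot A := by
  unfold indexPot; split_ifs <;> positivity

/-- The relative index is at least 2. Giving the whole group the potential 0 instead of 1 makes the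
expected potential an upper bound for the probability of failure, while this halving remains valid
in the last step. -/
theorem indexPot_le_half [Finite H] {A B : Subgroup H} (h : A < B) :
    indexPot B ≤ indexPot A / 2 := by
  have hA : A ≠ ⊤ := (h.trans_le le_top).ne
  have h1 := Subgroup.relIndex_mul_index h.le
  have h2 : A.relIndex B ≠ 0 := Subgroup.FiniteIndex.index_ne_zero
  have h3 : A.relIndex B ≠ 1 := fun h' => h.not_ge (Subgroup.relIndex_eq_one.1 h')
  have h4 : 2 * B.index ≤ A.index := by
    rw [← h1]; exact Nat.mul_le_mul_right _ (by omega)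
  have h5 : (2 * B.index : ℝ) ≤ A.index := by exact_mod_cast h4
  rw [indexPot, indexPot, if_neg hA]
  split_ifs
  · positivity
  · linarith

theorem span_cons (w : W) (L : List W) : span ρ L ≤ span ρ (w :: L) :=
  Subgroup.closure_mono fun _ ⟨w', hw', h⟩ => ⟨w', List.mem_cons_of_mem _ hw', h⟩

theorem mem_span {w : W} {L : List W} (h : w ∈ L) : ρ w ∈ span ρ L :=
  Subgroup.subset_closure ⟨w, h, rfl⟩

theorem span_cons_of_mem {w : W} {L : List W} (h : ρ w ∈ span ρ L) :
    span ρ (w :: L) = span ρ L := by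
  refine le_antisymm ?_ (span_cons w L)
  rw [span, Subgroup.closure_le]
  rintro _ ⟨w', hw', rfl⟩
  rcases List.mem_cons.1 hw' with rfl | hw'
  · exact h
  · exact mem_span hw'

theorem indexPot_span_cons_of_notMem [Finite H] {w : W} {L : List W} (h : ρ w ∉ span ρ L) :
    indexPot (span ρ (w :: L)) ≤ indexPot (span ρ L) / 2 :=
  indexPot_le_half (lt_of_le_of_ne (span_cons w L) fun he => h (he ▸ mem_span (by simp)))

theorem indexPot_span_cons_le [Finite H] (w : W) (L : List W) :
    indexPot (span ρ (w :: L)) ≤ indexPot (span ρ L) := by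
  by_cases h : ρ w ∈ span ρ L
  · rw [span_cons_of_mem h]
  · have := indexPot_nonneg (span ρ L)
    linarith [indexPot_span_cons_of_notMem h]

omit [(expLang Ω).Structure H] in
theorem E_grow_le_self [Finite H] (s : List W) (R : ℕ) (l : List (Σ k, Ω.Functions k))
    (X : List W) :
    (grow s R l X).E (fun X => indexPot (span ρ (X ++ s))) ≤ indexPot (span ρ (X ++ s)) := by
  induction l generalizing X with
  | nil => exact le_rfl
  | cons ω l ih =>
    rw [grow, E_bind]
    exact E_le fun v _ => (ih _).trans (indexPot_span_cons_le _ _)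

theorem E_grow_le [Finite H] (hρ : ∀ {k : ℕ} (f : (expLang Ω).Functions k) (x : Fin k → W),
      ρ (FirstOrder.Language.Structure.funMap f x) =
        FirstOrder.Language.Structure.funMap f fun i => ρ (x i))
    (hG : IsGroupOf Ω H) (hH : IsDistributive Ω H) (s : List W) {R : ℕ} (hR : 0 < R) {K : ℕ}
    {l : List (Σ k, Ω.Functions k)} (hK : ∀ ω ∈ l, ω.1 ≤ K) {X : List W}
    (hX : ∃ ω ∈ l, ∃ h : Fin ω.1 → H, (∀ i, h i ∈ span ρ (X ++ s)) ∧
      omegaOp Ω ω.2 h ∉ span ρ (X ++ s)) :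
    (grow s R l X).E (fun X => indexPot (span ρ (X ++ s))) ≤
      (1 - (1 / 2) ^ (K + 1)) * indexPot (span ρ (X ++ s)) := by
  induction l generalizing X with
  | nil => simp at hX
  | cons ω l ih =>
    rw [grow, E_bind]
    set A := span ρ (X ++ s) with hA
    have hA0 := indexPot_nonneg A
    -- If `ω` itself leads outside of `A`, its random value halves the potential with probability at
    -- least `2 ^ (-K)`, which gives the factor `1 - 2 ^ (-(K + 1))`. Otherwise either the new
    -- element already halves the potential, or the span is unchanged and a later symbol leads
    -- outside of it.
    by_cases hω : ∃ h : Fin ω.1 → H, (∀ i, h i ∈ A) ∧ omegaOp Ω ω.2 h ∉ A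
    · obtain ⟨h, hh, hn⟩ := hω
      have hd := E_draw_omega_le (map_addOp hρ hG) hG hH ω.2 (L := X ++ s) (A := A) rfl hh hn
        (zeroOp Ω W) hR fun _ => zeroOp Ω W
      have hb : ∀ v ∈ (drawSums Ω (X ++ s) R ω.1).support,
          ((grow s R l (omegaOp Ω ω.2 (fun i => v i) :: X)).E
            fun X => indexPot (span ρ (X ++ s))) ≤
          indexPot A / 2 + indexPot A / 2 * ind (omegaOp Ω ω.2 (fun i => ρ (v i)) ∈ A) := by
        intro v _
        refine (E_grow_le_self s R l _).trans ?_
        have hv : ρ (omegaOp Ω ω.2 fun i => v i) = omegaOp Ω ω.2 fun i => ρ (v i) := hρ _ _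
        by_cases hm : omegaOp Ω ω.2 (fun i => ρ (v i)) ∈ A
        · rw [ind_true hm]
          refine (indexPot_span_cons_le _ (X ++ s)).trans ?_
          rw [← hA]; linarith
        · rw [ind_false hm]
          rw [← hv] at hm
          refine (indexPot_span_cons_of_notMem hm).trans ?_
          rw [← hA]; linarith
      refine (E_mono hb).trans ?_
      rw [E_affine]
      have hp : ((1 : ℝ) / 2) ^ K ≤ (1 / 2) ^ ω.1 :=
        pow_le_pow_of_le_one (by norm_num) (by norm_num) (hK ω (by simp))
      have := mul_le_mul_of_nonneg_left (hd.trans (sub_le_sub_left hp 1))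
        (by linarith : 0 ≤ indexPot A / 2)
      rw [pow_succ]
      unfold drawSums
      linarith
    · refine E_le fun v _ => ?_
      set w := omegaOp Ω ω.2 fun i => v i with hw
      by_cases hm : ρ w ∈ A
      · have he : span ρ ((w :: X) ++ s) = A := span_cons_of_mem hm
        have := ih (X := w :: X) (fun ω h => hK ω (List.mem_cons_of_mem _ h)) (by
          rw [he]
          obtain ⟨ω', hω', h⟩ := hX
          rcases List.mem_cons.1 hω' with rfl | hω'
          · exact absurd h hω
          · exact ⟨ω', hω', h⟩)
        rwa [he] at this
      · refine (E_grow_le_self s R l _).trans ((indexPot_span_cons_of_notMem hm).trans ?_)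
        rw [← hA]
        have : ((1 : ℝ) / 2) ^ (K + 1) ≤ 1 / 2 := by
          rw [pow_succ]
          have : ((1 : ℝ) / 2) ^ K ≤ 1 := pow_le_one₀ (by norm_num) (by norm_num)
          linarith
        nlinarith

omit [(expLang Ω).Structure W] in
/-- As long as the additive group is not yet generated, some operation leads outside of the
subgroup generated so far. -/
theorem exists_omegaOp_notMem [Ω.IsAlgebraic] (hG : IsGroupOf Ω H) {s X : List W}
    (hs : FirstOrder.Language.Substructure.closure (expLang Ω) {h | ∃ w ∈ s, ρ w = h} = ⊤)
    (hX : span ρ (X ++ s) ≠ ⊤) {l : List (Σ k, Ω.Functions k)} (hl : ∀ ω, ω ∈ l) :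
    ∃ ω ∈ l, ∃ h : Fin ω.1 → H, (∀ i, h i ∈ span ρ (X ++ s)) ∧
      omegaOp Ω ω.2 h ∉ span ρ (X ++ s) := by
  by_contra! hc
  let S : (expLang Ω).Substructure H :=
    { carrier := span ρ (X ++ s)
      fun_mem := by
        intro k f x hx
        rcases f with f | ω
        · cases f with
          | add =>
            have h1 : x = ![x 0, x 1] := by funext i; fin_cases i <;> rfl
            have h2 := hG.mul (x 0) (x 1)
            rw [addOp, ← h1] at h2
            exact h2 ▸ mul_mem (hx 0) (hx 1)
          | neg =>
            have h1 : x = ![x 0] := by funext i; fin_cases i; rfl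
            have h2 := hG.inv (x 0)
            rw [negOp, ← h1] at h2
            exact h2 ▸ inv_mem (hx 0)
          | zero =>
            have h1 : x = ![] := by funext i; exact i.elim0
            have h2 := hG.one
            rw [zeroOp, ← h1] at h2
            exact h2 ▸ one_mem _
        · exact hc ⟨k, ω⟩ (hl _) x hx }
  have hle : FirstOrder.Language.Substructure.closure (expLang Ω) {h | ∃ w ∈ s, ρ w = h} ≤ S := by
    rw [FirstOrder.Language.Substructure.closure_le]
    rintro _ ⟨w, hw, rfl⟩
    exact mem_span (List.mem_append_right _ hw)
  rw [hs] at hle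
  exact hX ((Subgroup.eq_top_iff' _).2 fun x => hle (FirstOrder.Language.Substructure.mem_top x))

/-- Markov's inequality in disguise: the expected potential bounds the probability that the additive
group is not generated. -/
theorem ind_span_ne_top_le [Finite H] (A : Subgroup H) : ind (A ≠ ⊤) ≤ indexPot A := by
  by_cases h : A = ⊤
  · rw [ind_false (not_not.2 h)]; exact indexPot_nonneg A
  · rw [ind_true h, indexPot, if_neg h]
    exact_mod_cast Nat.one_le_iff_ne_zero.2 Subgroup.FiniteIndex.index_ne_zero

theorem indexPot_le_card [Finite H] (A : Subgroup H) : indexPot A ≤ Nat.card H := by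
  rw [indexPot]
  split_ifs
  · positivity
  · exact_mod_cast Nat.le_of_dvd Nat.card_pos A.index_dvd_card

/-- The algorithm accepts the members of the variety. -/
theorem E_testMember_eq_one {l : List (Σ k, Ω.Functions k)}
    {ids : List ((expLang Ω).Term ℕ × (expLang Ω).Term ℕ)} {R m M₁ M₂ n : ℕ}
    {eqv : W → W → Bool} {s : List W}
    (h : ∀ e ∈ ids, ∀ v : ℕ → W, eqv (e.1.realize v) (e.2.realize v) = true) :
    (testMember l ids R m M₁ M₂ n eqv s).E (fun b => ind (b = true)) = 1 := by
  have hp : ∀ v : ℕ → W, passes ids eqv v true = true := fun v =>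
    (passes_eq ids eqv v true).2 ⟨rfl, fun e he => h e he v⟩
  have hf : ∀ v : ℕ → W, passes ids eqv v false = false := fun v => by
    rw [← Bool.not_eq_true, passes_eq]; simp
  rw [testMember, E_bind]
  have : ∀ X : List W, (iter (iter (check ids eqv (X ++ s) R m) M₂) n true).E
      (fun b => ind (b = true)) = 1 := by
    intro X
    rw [E_iter_eq (fun b => E_iter_eq (fun b => ?_) M₂ b) n true, ind_true rfl]
    rw [check, E_bind]
    cases b
    · simp only [hf, E, E_const]
    · simp only [hp, E, E_const]
  simp only [this, E_const]

/-- The algorithm most likely rejects if a random check is likely to fail. -/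
theorem E_testMember_le [Finite H] [Ω.IsAlgebraic]
    (hρ : ∀ {k : ℕ} (f : (expLang Ω).Functions k) (x : Fin k → W),
      ρ (FirstOrder.Language.Structure.funMap f x) =
        FirstOrder.Language.Structure.funMap f fun i => ρ (x i))
    (hG : IsGroupOf Ω H) (hH : IsDistributive Ω H) {s : List W}
    (hs : FirstOrder.Language.Substructure.closure (expLang Ω) {h | ∃ w ∈ s, ρ w = h} = ⊤)
    {R : ℕ} (hR : 0 < R) {K : ℕ} {l : List (Σ k, Ω.Functions k)} (hl : ∀ ω, ω ∈ l)
    (hK : ∀ ω ∈ l, ω.1 ≤ K) {ids : List ((expLang Ω).Term ℕ × (expLang Ω).Term ℕ)}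
    {eqv : W → W → Bool} {m : ℕ} {q : ℝ} (hq : 0 ≤ q)
    (hids : ∀ L : List W, span ρ L = ⊤ →
      (drawSums Ω L R m).E (fun v => ind (passes ids eqv v true = true)) ≤ q) (M₁ M₂ n : ℕ) :
    (testMember l ids R m M₁ M₂ n eqv s).E (fun b => ind (b = true)) ≤
      ((1 - (1 / 2) ^ (K + 1)) ^ M₁) ^ n * Nat.card H + (q ^ M₂) ^ n := by
  have hf : ∀ v : ℕ → W, passes ids eqv v false = false := fun v => by
    rw [← Bool.not_eq_true, passes_eq]; simp
  have hK1 : (0 : ℝ) ≤ 1 - (1 / 2) ^ (K + 1) := by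
    have : ((1 : ℝ) / 2) ^ (K + 1) ≤ 1 := pow_le_one₀ (by norm_num) (by norm_num)
    linarith
  have h1 : (iter (iter (grow s R l) M₁) n []).E (fun X => indexPot (span ρ (X ++ s))) ≤
      ((1 - (1 / 2) ^ (K + 1)) ^ M₁) ^ n * Nat.card H := by
    refine (E_iter_le (Ψ := fun X => indexPot (span ρ (X ++ s))) (by positivity)
      (fun X => E_iter_le hK1 (fun X => ?_) M₁ X) n []).trans
      (mul_le_mul_of_nonneg_left (indexPot_le_card _) (by positivity))
    by_cases hX : span ρ (X ++ s) = ⊤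
    · refine (E_grow_le_self s R l X).trans_eq ?_
      rw [hX, indexPot, if_pos rfl, mul_zero]
    · exact E_grow_le hρ hG hH s hR hK (exists_omegaOp_notMem hG hs hX hl)
  have h2 : ∀ X : List W, (iter (iter (check ids eqv (X ++ s) R m) M₂) n true).E
      (fun b => ind (b = true)) ≤ (q ^ M₂) ^ n + 1 * indexPot (span ρ (X ++ s)) := by
    intro X
    by_cases hX : span ρ (X ++ s) = ⊤
    · refine (E_iter_le (Ψ := fun b => ind (b = true)) (by positivity)
        (fun b => E_iter_le hq (fun b => ?_) M₂ b) n true).trans ?_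
      · rw [check, E_bind]
        cases b
        · simp only [hf, E, E_const]
          rw [ind_false (by simp)]; simp
        · rw [ind_true rfl, mul_one]
          exact hids _ hX
      · rw [ind_true rfl]
        have := indexPot_nonneg (span ρ (X ++ s))
        linarith
    · refine (E_le fun _ _ => ind_le_one _).trans ?_
      have := ind_span_ne_top_le (span ρ (X ++ s))
      rw [ind_true hX] at this
      have : 0 ≤ (q ^ M₂) ^ n := by positivity
      linarith
  rw [testMember, E_bind]
  refine (E_mono fun X _ => h2 X).trans ?_
  rw [E_affine]
  linarith

end Algorithm

/-! ### Programs that realize random computations -/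

section Impl

variable {L : FirstOrder.Language.{u, u'}} {D : Set (List Bool)} {O : Oracle L} {α β : Type}

/-- Every toss costs time. So whenever there are at least as many outcomes as the total time bound,
enough remain for the program that runs next. -/
theorem Exec.length_le {P : Prog L} {st st' : Store} {r r' : List Bool} {t : ℕ}
    (h : Exec D O P st r st' r' t) : r.length ≤ r'.length + t := by
  induction h with
  | toss => simp [List.length_cons]
  | _ => omega

variable (D O) in
/-- Started with the store `st`, the program `P` carries out the random computation `c` in time
`T`; the relation `Post` holds between the value and the final store. -/
def Impl (P : Prog L) (st : Store) (c : Coin α) (Post : α → Store → Prop) (T : ℕ) : Prop :=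
  ∀ r : List Bool, T ≤ r.length → ∃ a r' st' t, c.run r = some (a, r') ∧
    Exec D O P st r st' r' t ∧ t ≤ T ∧ Post a st'

namespace Impl

variable {P Q : Prog L} {st : Store} {c : Coin α} {Post : α → Store → Prop} {T T₁ T₂ : ℕ}

theorem mono {Post' : α → Store → Prop} (h : Impl D O P st c Post T₁)
    (hP : ∀ a st', Post a st' → Post' a st') (hT : T₁ ≤ T₂) : Impl D O P st c Post' T₂ := by
  intro r hr
  obtain ⟨a, r', st', t, h1, h2, h3, h4⟩ := h r (hT.trans hr)
  exact ⟨a, r', st', t, h1, h2, h3.trans hT, hP _ _ h4⟩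

theorem le (h : Impl D O P st c Post T₁) (hT : T₁ ≤ T₂) : Impl D O P st c Post T₂ :=
  h.mono (fun _ _ h => h) hT

theorem seq {d : α → Coin β} {Post' : β → Store → Prop} (h : Impl D O P st c Post T₁)
    (h' : ∀ a st', Post a st' → Impl D O Q st' (d a) Post' T₂) :
    Impl D O (.seq P Q) st (c.bind d) Post' (T₁ + T₂) := by
  intro r hr
  obtain ⟨a, r', st', t, h1, h2, h3, h4⟩ := h r (by omega)
  obtain ⟨b, r'', st'', t', h1', h2', h3', h4'⟩ := h' a st' h4 r' (by
    have := h2.length_le; omega)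
  exact ⟨b, r'', st'', t + t', by rw [run_bind, h1]; exact h1', h2.seq h2', by omega, h4'⟩

theorem seq_pure {Post' : α → Store → Prop} (h : Impl D O P st c Post T₁)
    (h' : ∀ a st', Post a st' → Impl D O Q st' (.pure a) Post' T₂) :
    Impl D O (.seq P Q) st c Post' (T₁ + T₂) := by
  rw [← c.bind_pure]; exact h.seq h'

theorem assign {x : ℕ} {e : Expr} {a : α} (hP : Post a (Function.update st x (e.eval st)))
    (hT : 1 + (e.eval st).size ≤ T) : Impl D O (.assign x e) st (.pure a) Post T :=
  fun r _ => ⟨a, r, _, _, rfl, .assign x e st r, hT, hP⟩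

theorem toss {x : ℕ} {c₁ c₂ : Coin α}
    (h₁ : Impl D O Q (Function.update st x (Data.bit false)) c₁ Post T)
    (h₂ : Impl D O Q (Function.update st x (Data.bit true)) c₂ Post T) :
    Impl D O (.seq (.toss x) Q) st (.flip c₁ c₂) Post (4 + T) := by
  intro r hr
  cases r with
  | nil => simp at hr
  | cons b r =>
    rw [List.length_cons] at hr
    cases b with
    | false =>
      obtain ⟨a, r', st', t, h1, h2, h3, h4⟩ := h₁ r (by omega)
      exact ⟨a, r', st', _, h1, (Exec.toss x st false r).seq h2, by simp [Data.bit, Data.size]; omega, h4⟩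
    | true =>
      obtain ⟨a, r', st', t, h1, h2, h3, h4⟩ := h₂ r (by omega)
      exact ⟨a, r', st', _, h1, (Exec.toss x st true r).seq h2, by simp [Data.bit, Data.size]; omega, h4⟩

theorem cond_true {e : Expr} (he : e.eval st ≠ Data.nil) (h : Impl D O P st c Post T) :
    Impl D O (.cond e P Q) st c Post (1 + T) := by
  intro r hr
  obtain ⟨a, r', st', t, h1, h2, h3, h4⟩ := h r (by omega)
  exact ⟨a, r', st', _, h1, .cond_true he h2, by omega, h4⟩

theorem cond_false {e : Expr} (he : e.eval st = Data.nil) (h : Impl D O Q st c Post T) :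
    Impl D O (.cond e P Q) st c Post (1 + T) := by
  intro r hr
  obtain ⟨a, r', st', t, h1, h2, h3, h4⟩ := h r (by omega)
  exact ⟨a, r', st', _, h1, .cond_false he h2, by omega, h4⟩

theorem loop_false {e : Expr} {a : α} (he : e.eval st = Data.nil) (hP : Post a st) (hT : 1 ≤ T) :
    Impl D O (.loop e P) st (.pure a) Post T :=
  fun r _ => ⟨a, r, _, _, rfl, .loop_false he, hT, hP⟩

theorem loop_true {e : Expr} {d : α → Coin β} {Post' : β → Store → Prop}
    (he : e.eval st ≠ Data.nil) (h : Impl D O P st c Post T₁)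
    (h' : ∀ a st', Post a st' → Impl D O (.loop e P) st' (d a) Post' T₂) :
    Impl D O (.loop e P) st (c.bind d) Post' (1 + T₁ + T₂) := by
  intro r hr
  obtain ⟨a, r', st', t, h1, h2, h3, h4⟩ := h r (by omega)
  obtain ⟨b, r'', st'', t', h1', h2', h3', h4'⟩ := h' a st' h4 r' (by
    have := h2.length_le; omega)
  exact ⟨b, r'', st'', 1 + t + t', by rw [run_bind, h1]; exact h1', .loop_true he h2 h2',
    by omega, h4'⟩

end Impl

/-- The program that does nothing. -/
def skip : Prog L := .loop .nil (.assign 0 .nil)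

theorem Impl.skip {st : Store} {a : α} {Post : α → Store → Prop} {T : ℕ} (hP : Post a st)
    (hT : 1 ≤ T) : Impl D O skip st (.pure a) Post T := .loop_false rfl hP hT

/-- Run `P` a fixed number of times. -/
def iterProg (P : Prog L) : ℕ → Prog L
  | 0 => skip
  | M + 1 => .seq P (iterProg P M)

theorem Impl.iterProg {P : Prog L} {f : α → Coin α} {Inv : ℕ → α → Store → Prop} {T : ℕ} {M i : ℕ}
    {a : α} {st : Store} (h0 : Inv i a st)
    (hP : ∀ j a st, j < i + M → Inv j a st → Impl D O P st (f a) (Inv (j + 1)) T) :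
    Impl D O (iterProg P M) st (iter f M a) (Inv (i + M)) (M * T + 1) := by
  induction M generalizing i a st with
  | zero => exact .skip h0 (by omega)
  | succ M ih =>
    refine (Impl.seq (hP i a st (by omega) h0) fun a' st' h' => ih (i := i + 1) h' fun j a st hj =>
      hP j a st (by omega)).mono (fun a st h => ?_) (by rw [Nat.succ_mul]; omega)
    rwa [show i + (M + 1) = i + 1 + M by omega]

/-- Run programs one after the other. -/
def seqFin : (k : ℕ) → (Fin k → Prog L) → Prog L
  | 0, _ => skip
  | k + 1, P => .seq (seqFin k fun i => P i.castSucc) (P (Fin.last k))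

theorem Impl.seqFin {k : ℕ} {P : Fin k → Prog L} {Inv : ℕ → Store → Prop} {T : Fin k → ℕ}
    {st : Store} (h0 : Inv 0 st) (hP : ∀ (i : Fin k) st, Inv i st →
      Impl D O (P i) st (.pure ()) (fun _ => Inv (i + 1)) (T i)) :
    Impl D O (seqFin k P) st (.pure ()) (fun _ => Inv k) (∑ i, T i + 1) := by
  induction k with
  | zero => exact .skip h0 (by omega)
  | succ k ih =>
    refine (Impl.seq_pure (ih fun i st h => hP i.castSucc st h) fun a st' h' =>
      hP (Fin.last k) st' h').le ?_
    rw [Fin.sum_univ_castSucc]; omega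

/-- Run `P` as many times as register `0` says. -/
def forProg (P : Prog L) : Prog L :=
  .seq (.assign 1 (.hd (.var 0))) (.loop (.var 1) (.seq (.assign 1 (.tl (.var 1))) P))

theorem size_bit_le (b : Bool) : (Data.bit b).size ≤ 3 := by cases b <;> simp [Data.bit, Data.size]

theorem size_word_le (w : List Bool) : (Data.word w).size ≤ 4 * w.length + 1 := by
  induction w with
  | nil => simp [Data.word, Data.list, Data.size]
  | cons b w ih =>
    have := size_bit_le b
    simp only [Data.word, List.map_cons, Data.list, Data.size, List.length_cons] at ih ⊢
    omega

/-- The unary `n` in the input is copied to register `1` and consumed as a counter; `S` bounds the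
cost of storing it. The invariant must therefore ignore register `1`, and the body must preserve it.
-/
theorem Impl.forProg {P : Prog L} {f : α → Coin α} {Inv : ℕ → α → Store → Prop} {T S n : ℕ}
    {a : α} {st : Store} (hS : 4 * n + 2 ≤ S) (h0 : Inv 0 a st)
    (hn : (st 0).hd = Data.word (List.replicate n true))
    (hInv : ∀ i a st d, Inv i a st → Inv i a (Function.update st 1 d))
    (hP : ∀ i a st, i < n → Inv i a st → Impl D O P st (f a)
      (fun a' st' => Inv (i + 1) a' st' ∧ st' 1 = st 1) T) :
    Impl D O (forProg P) st (iter f n a) (Inv n) (S + (n * (1 + S + T) + 1)) := by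
  have hsz : ∀ m ≤ n, 1 + (Data.word (List.replicate m true)).size ≤ S := fun m hm => by
    have := size_word_le (List.replicate m true)
    rw [List.length_replicate] at this
    omega
  have key : ∀ m i a st, i + m = n → Inv i a st → st 1 = Data.word (List.replicate m true) →
      Impl D O (.loop (.var 1) (.seq (.assign 1 (.tl (.var 1))) P)) st (iter f m a) (Inv n)
        (m * (1 + S + T) + 1) := by
    intro m
    induction m with
    | zero =>
      intro i a st hi hI h1
      refine .loop_false (by simpa [Expr.eval, Data.word, Data.list] using h1) ?_ (by omega)
      rwa [show n = i by omega]
    | succ m ih =>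
      intro i a st hi hI h1
      have he : (Expr.tl (.var 1)).eval st = Data.word (List.replicate m true) := by
        simp [Expr.eval, h1, Data.word, Data.list, List.replicate_succ, Data.tl]
      have hbody : Impl D O (.seq (.assign 1 (.tl (.var 1))) P) st (f a)
          (fun a' st' => Inv (i + 1) a' st' ∧ st' 1 = Data.word (List.replicate m true))
          (S + T) := by
        refine Impl.seq (c := .pure ()) (d := fun _ => f a)
          (Post := fun _ st' => st' = Function.update st 1 (Data.word (List.replicate m true)))
          (.assign (by rw [he]) (by rw [he]; exact hsz m (by omega))) ?_
        rintro _ _ rfl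
        refine (hP i a _ (by omega) (hInv _ _ _ _ hI)).mono (fun a' st' h => ⟨h.1, ?_⟩) le_rfl
        rw [h.2]; simp
      refine (Impl.loop_true ?_ hbody fun a' st' h => ih (i + 1) a' st' (by omega) h.1 h.2).le ?_
      · simp [Expr.eval, h1, Data.word, Data.list, List.replicate_succ]
      · rw [Nat.succ_mul]; omega
  refine Impl.seq (c := .pure ()) (d := fun _ => iter f n a)
    (Post := fun _ st' => st' = Function.update st 1 (Data.word (List.replicate n true)))
    (.assign (by rw [Expr.eval, Expr.eval, hn]) (by rw [Expr.eval, Expr.eval, hn]; exact hsz n le_rfl)) ?_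
  rintro _ _ rfl
  exact key n 0 a _ (by omega) (hInv _ _ _ _ h0) (by simp)

end Impl

/-! ### Programs that compute with representations -/

section Words

variable {Ω : FirstOrder.Language.{u, u'}} {D : Set (List Bool)} {O : Oracle (expLang Ω)}

/-- The data encoding a bit string. -/
def enc (w : D) : Data := Data.word (w : List Bool)

/-- The data encoding a list of bit strings. -/
def encList (X : List D) : Data := Data.list (X.map enc)

theorem size_encList_le {n : ℕ} (hD : ∀ w ∈ D, w.length = n) (X : List D) :
    (encList X).size ≤ X.length * (4 * n + 2) + 1 := by
  induction X with
  | nil => simp [encList, Data.list, Data.size]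
  | cons w X ih =>
    have := size_word_le (w : List Bool)
    rw [hD w w.2] at this
    simp only [encList, List.map_cons, Data.list, Data.size, List.length_cons, enc] at ih ⊢
    rw [Nat.succ_mul]
    omega

variable (D O) in
/-- The algebra of bit strings with the operations computed by the oracle. -/
structure IsWordAlgebra [(expLang Ω).Structure D] (n : ℕ) : Prop where
  length : ∀ w ∈ D, w.length = n
  op : ∀ {k : ℕ} (f : (expLang Ω).Functions k) (w : Fin k → D),
    ((FirstOrder.Language.Structure.funMap f w : D) : List Bool) = O.op f fun i => (w i : List Bool)

variable [(expLang Ω).Structure D] {n : ℕ} (hW : IsWordAlgebra D O n)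

include hW

theorem one_add_size_enc_le {S : ℕ} (hS : 4 * n + 4 ≤ S) (w : D) : 1 + (enc w).size ≤ S := by
  have := size_word_le (w : List Bool)
  rw [hW.length w w.2] at this
  rw [enc]; omega

theorem Impl.queryOp {α : Type} {a : α} {x k : ℕ} {f : (expLang Ω).Functions k} {e : Fin k → Expr}
    {st : Store} {w : Fin k → D} {Post : α → Store → Prop} {S : ℕ}
    (he : ∀ i, (e i).eval st = enc (w i))
    (hP : Post a (Function.update st x (enc (FirstOrder.Language.Structure.funMap f w : D))))
    (hS : 4 * n + 4 ≤ S) : Impl D O (.queryOp x f e) st (.pure a) Post S := by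
  have h := one_add_size_enc_le hW hS (FirstOrder.Language.Structure.funMap f w)
  rw [enc, hW.op] at h hP
  exact fun r _ => ⟨a, r, _, _, rfl, .queryOp x f r (fun i => (w i).2) he, h, hP⟩

omit hW [(expLang Ω).Structure D] in
theorem Impl.queryEq {α : Type} {a : α} {x : ℕ} {e₁ e₂ : Expr}
    {st : Store} {w₁ w₂ : D} {Post : α → Store → Prop} {S : ℕ}
    (he₁ : e₁.eval st = enc w₁) (he₂ : e₂.eval st = enc w₂)
    (hP : Post a (Function.update st x (Data.bit (O.eqv w₁ w₂))))
    (hS : 4 ≤ S) : Impl D O (.queryEq x e₁ e₂) st (.pure a) Post S := by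
  have := size_bit_le (O.eqv w₁ w₂)
  exact fun r _ => ⟨a, r, _, _, rfl, .queryEq x r w₁.2 w₂.2 he₁ he₂, by omega, hP⟩

omit hW in
/-- Add a random subsum of the list in register `4` to register `5`. -/
def subsumProg (Ω : FirstOrder.Language.{u, u'}) : Prog (expLang Ω) :=
  .loop (.var 4) (.seq (.toss 6) (.seq
    (.cond (.var 6) (.queryOp 5 (k := 2) (Sum.inl GroupSymbol.add) ![.var 5, .hd (.var 4)]) skip)
    (.assign 4 (.tl (.var 4)))))

/-- Register `4` holds the rest of the list, `5` the accumulator and `6` the coin. Oracle answers on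
representations have length `n`, so `S` bounds the cost of every stored word or list, and each pass
of the loop takes time at most `4 * S`. -/
theorem impl_subsumProg {S ℓ : ℕ} (hS : (ℓ + 1) * (4 * n + 4) ≤ S) (X : List D)
    (hX : X.length ≤ ℓ) (acc : D) (st : Store) (h4 : st 4 = encList X) (h5 : st 5 = enc acc) :
    Impl D O (subsumProg Ω) st (subsum (addOp Ω) X acc) (fun a st' => st' 5 = enc a ∧
      ∀ x, x ≠ 4 → x ≠ 5 → x ≠ 6 → st' x = st x) (X.length * (4 * S) + 1) := by
  have hS0 : 4 * n + 4 ≤ S := le_trans (Nat.le_mul_of_pos_left _ (Nat.succ_pos _)) hS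
  induction X generalizing acc st with
  | nil => exact .loop_false h4 ⟨h5, fun _ _ _ _ => rfl⟩ (by omega)
  | cons l X ih =>
    have htl : 1 + (encList X).size ≤ S := by
      have := size_encList_le hW.length X
      rw [List.length_cons] at hX
      nlinarith
    have step : ∀ (st' : Store) (acc' : D), st' 4 = encList (l :: X) → st' 5 = enc acc' →
        (∀ x, x ≠ 4 → x ≠ 5 → x ≠ 6 → st' x = st x) →
        Impl D O (.assign 4 (.tl (.var 4)) : Prog (expLang Ω)) st' (.pure acc')
          (fun a st' => st' 4 = encList X ∧ st' 5 = enc a ∧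
            ∀ x, x ≠ 4 → x ≠ 5 → x ≠ 6 → st' x = st x) S := by
      intro st' acc' h4' h5' hx'
      have he : (Expr.tl (.var 4)).eval st' = encList X := by
        simp [Expr.eval, h4', encList, Data.list, Data.tl]
      refine .assign ⟨by rw [he]; simp, by simpa using h5', fun x h1 h2 h3 => ?_⟩
        (by rw [he]; exact htl)
      rw [Function.update_of_ne h1]; exact hx' x h1 h2 h3
    have h4n : (Expr.var 4).eval st ≠ Data.nil := by
      simp [Expr.eval, h4, encList, Data.list]
    have body : Impl D O (.seq (.toss 6) (.seq
        (.cond (.var 6) (.queryOp 5 (k := 2) (Sum.inl GroupSymbol.add) ![.var 5, .hd (.var 4)]) skip)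
        (.assign 4 (.tl (.var 4)))) : Prog (expLang Ω)) st
        (.flip (.pure acc) (.pure (addOp Ω acc l)))
        (fun a st' => st' 4 = encList X ∧ st' 5 = enc a ∧
            ∀ x, x ≠ 4 → x ≠ 5 → x ≠ 6 → st' x = st x) (4 + (1 + S + S)) := by
      refine .toss ?_ ?_
      · refine Impl.seq_pure (Impl.cond_false (by simp [Expr.eval, Data.bit])
          (.skip (Post := fun a st' => a = acc ∧
            st' = Function.update st 6 (Data.bit false)) ⟨rfl, rfl⟩ (by omega))) ?_
        rintro _ _ ⟨rfl, rfl⟩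
        exact step _ _ (by simpa using h4) (by simpa using h5)
          fun x _ _ h6 => Function.update_of_ne h6 _ _
      · refine Impl.seq_pure (Impl.cond_true (by simp [Expr.eval, Data.bit])
          (.queryOp hW (w := ![acc, l]) (Post := fun a st' => a = addOp Ω acc l ∧
            st' = Function.update (Function.update st 6 (Data.bit true)) 5
              (enc (addOp Ω acc l))) ?_ ⟨rfl, rfl⟩ hS0)) ?_
        · intro i
          fin_cases i
          · simpa [Expr.eval] using h5
          · simp [Expr.eval, h4, encList, Data.list, Data.hd]
        · rintro _ _ ⟨rfl, rfl⟩
          exact step _ _ (by simpa using h4) (by simp) fun x _ h5 h6 => by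
            rw [Function.update_of_ne h5, Function.update_of_ne h6]
    refine (Impl.loop_true h4n body fun a st' h =>
      (ih (by rw [List.length_cons] at hX; omega) a st' h.1 h.2.1).mono
        (Post' := fun a st' => st' 5 = enc a ∧ ∀ x, x ≠ 4 → x ≠ 5 → x ≠ 6 → st' x = st x)
        (fun a st'' h' => ⟨h'.1, fun x h1 h2 h3 => ?_⟩) le_rfl).le ?_
    · rw [h'.2 x h1 h2 h3, h.2.2 x h1 h2 h3]
    · rw [List.length_cons, Nat.succ_mul X.length]; omega

omit hW in
/-- Add `R` random subsums of the list in register `2` to register `5`. -/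
def sampleProg (Ω : FirstOrder.Language.{u, u'}) : ℕ → Prog (expLang Ω)
  | 0 => skip
  | R + 1 => .seq (.assign 4 (.var 2)) (.seq (subsumProg Ω) (sampleProg Ω R))

variable {ℓ S U : ℕ} (hS : (ℓ + 1) * (4 * n + 4) ≤ S) (hU : (ℓ + 1) * S ≤ U)

include hS hU

/-- From here on `S` bounds the cost of storing a list of at most `ℓ` words, and `U` dominates the
cost of handling each of its elements. The list in register `2` is not consumed, so it can be copied
for each subsum. -/
theorem impl_sampleProg {X : List D}
    (hX : X.length ≤ ℓ) (R : ℕ) (acc : D) (st : Store) (h2 : st 2 = encList X)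
    (h5 : st 5 = enc acc) :
    Impl D O (sampleProg Ω R) st (sample (addOp Ω) X R acc) (fun a st' => st' 5 = enc a ∧
      ∀ x, x ≠ 4 → x ≠ 5 → x ≠ 6 → st' x = st x) (R * (5 * U) + 1) := by
  have hsz : 1 + (encList X).size ≤ S := by
    have := size_encList_le hW.length X
    nlinarith
  induction R generalizing acc st with
  | zero => exact .skip ⟨h5, fun _ _ _ _ => rfl⟩ (by omega)
  | succ R ih =>
    have h1 : Impl D O (.assign 4 (.var 2) : Prog (expLang Ω)) st (.pure ())
        (fun _ st' => st' = Function.update st 4 (encList X)) S :=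
      .assign (by rw [Expr.eval, h2]) (by rw [Expr.eval, h2]; exact hsz)
    refine (h1.seq (d := fun _ => sample (addOp Ω) X (R + 1) acc)
      (T₂ := (X.length * (4 * S) + 1) + (R * (5 * U) + 1)) ?_).le ?_
    · rintro _ _ rfl
      refine Impl.seq (impl_subsumProg hW hS X hX acc _ (by simp) (by simpa using h5)) ?_
      rintro a st' ⟨h5', hx'⟩
      refine (ih a st' (by rw [hx' 2 (by omega) (by omega) (by omega)]; simpa using h2) h5').mono
        (fun a st'' h => ⟨h.1, fun x h4 h5 h6 => ?_⟩) le_rfl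
      rw [h.2 x h4 h5 h6, hx' x h4 h5 h6, Function.update_of_ne h4]
    · have : 1 ≤ S := le_trans (by omega) hsz
      have : X.length * (4 * S) ≤ ℓ * (4 * S) := Nat.mul_le_mul_right _ hX
      have : (R + 1) * (5 * U) = R * (5 * U) + 5 * U := by ring
      nlinarith

omit hW hS hU in
/-- Store random sums of elements of the list in register `2` in the registers `8, …, 7 + k`. -/
def drawProg (Ω : FirstOrder.Language.{u, u'}) (R : ℕ) : ℕ → Prog (expLang Ω)
  | 0 => skip
  | k + 1 => .seq (drawProg Ω R k) (.seq (.queryOp 5 (k := 0) (Sum.inl GroupSymbol.zero) ![])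
      (.seq (sampleProg Ω R) (.assign (8 + k) (.var 5))))

theorem impl_drawProg {X : List D} (hX : X.length ≤ ℓ) (R k : ℕ) (st : Store)
    (h2 : st 2 = encList X) :
    Impl D O (drawProg Ω R k) st (drawSums Ω X R k) (fun v st' =>
      (∀ i < k, st' (8 + i) = enc (v i)) ∧ ∀ x < 4, st' x = st x)
      ((k * (5 * R + 3) + 1) * U) := by
  have hS0 : 4 * n + 4 ≤ S := le_trans (Nat.le_mul_of_pos_left _ (Nat.succ_pos _)) hS
  have hSU : S ≤ U := le_trans (Nat.le_mul_of_pos_left _ (Nat.succ_pos _)) hU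
  induction k with
  | zero => exact .skip ⟨fun i hi => absurd hi (by omega), fun _ _ => rfl⟩ (by omega)
  | succ k ih =>
    refine (Impl.seq ih (T₂ := S + ((R * (5 * U) + 1) + S)) ?_).le ?_
    · rintro v st' ⟨hv, hx⟩
      refine Impl.seq (c := .pure ()) (d := fun _ => (sample (addOp Ω) X R (zeroOp Ω D)).bind
        fun y => .pure (Function.update v k y)) (.queryOp hW (w := ![])
        (Post := fun _ st'' => st'' = Function.update st' 5 (enc (zeroOp Ω D)))
        (fun i => i.elim0) rfl hS0) ?_
      rintro _ _ rfl
      refine Impl.seq (impl_sampleProg hW hS hU hX R (zeroOp Ω D) _ ?_ (by simp)) ?_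
      · rw [Function.update_of_ne (by omega), hx 2 (by omega), h2]
      · rintro y st'' ⟨h5, hx'⟩
        refine .assign ⟨fun i hi => ?_, fun x hx'' => ?_⟩
          (by rw [Expr.eval, h5]; exact one_add_size_enc_le hW hS0 y)
        · rw [Expr.eval, h5]
          by_cases hik : i = k
          · subst hik; simp
          · rw [Function.update_of_ne (by omega), Function.update_of_ne hik,
              hx' _ (by omega) (by omega) (by omega), Function.update_of_ne (by omega),
              hv i (by omega)]
        · rw [Function.update_of_ne (by omega), hx' x (by omega) (by omega) (by omega),
            Function.update_of_ne (by omega), hx x hx'']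
    · nlinarith

omit hW hS hU in
/-- Enlarge the list in register `2` by random values of the operations. -/
def growProg (R : ℕ) : List (Σ k, Ω.Functions k) → Prog (expLang Ω)
  | [] => skip
  | ω :: l => .seq (drawProg Ω R ω.1) (.seq
      (.queryOp 5 (k := ω.1) (Sum.inr ω.2) fun i => .var (8 + i))
      (.seq (.assign 2 (.cons (.var 5) (.var 2))) (growProg R l)))

omit hW hS hU in
/-- The number of time units used by `growProg`. -/
def growCost (R : ℕ) : List (Σ k, Ω.Functions k) → ℕ
  | [] => 1
  | ω :: l => (ω.1 * (5 * R + 3) + 1) + 2 + growCost R l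

theorem impl_growProg {s : List D} (R : ℕ) (l : List (Σ k, Ω.Functions k)) (X : List D)
    (hX : X.length + l.length + s.length ≤ ℓ) (st : Store) (h2 : st 2 = encList (X ++ s)) :
    Impl D O (growProg R l) st (grow s R l X) (fun X' st' => st' 2 = encList (X' ++ s) ∧
      X'.length = X.length + l.length ∧ ∀ x < 4, x ≠ 2 → st' x = st x) (growCost R l * U) := by
  have hS0 : 4 * n + 4 ≤ S := le_trans (Nat.le_mul_of_pos_left _ (Nat.succ_pos _)) hS
  have hSU : S ≤ U := le_trans (Nat.le_mul_of_pos_left _ (Nat.succ_pos _)) hU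
  induction l generalizing X st with
  | nil => exact .skip ⟨h2, rfl, fun _ _ _ => rfl⟩ (by rw [growCost]; omega)
  | cons ω l ih =>
    rw [List.length_cons] at hX
    refine (Impl.seq (impl_drawProg hW hS hU (by rw [List.length_append]; omega) R ω.1 st h2)
      (T₂ := S + (S + growCost R l * U)) ?_).le (by rw [growCost]; nlinarith)
    rintro v st' ⟨hv, hx⟩
    set w : D := omegaOp Ω ω.2 fun i => v i with hw
    refine Impl.seq (c := .pure ()) (d := fun _ => grow s R l (w :: X))
      (.queryOp hW (w := fun i => v i)
        (Post := fun _ st'' => st'' = Function.update st' 5 (enc w))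
        (fun i => hv i i.2) rfl hS0) ?_
    rintro _ _ rfl
    have he : (Expr.cons (.var 5) (.var 2)).eval (Function.update st' 5 (enc w)) =
        encList ((w :: X) ++ s) := by
      simp [Expr.eval, hx 2 (by omega), h2, encList, Data.list]
    refine Impl.seq (c := .pure ()) (d := fun _ => grow s R l (w :: X))
      (.assign (Post := fun _ st'' => st'' = Function.update (Function.update st' 5 (enc w)) 2
        (encList ((w :: X) ++ s))) (by rw [he]) ?_) ?_
    · rw [he]
      have := size_encList_le hW.length ((w :: X) ++ s)
      have h3 : ((w :: X) ++ s).length ≤ ℓ := by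
        rw [List.length_append, List.length_cons]; omega
      nlinarith
    · rintro _ _ rfl
      refine (ih (w :: X) (by rw [List.length_cons]; omega) _ (by simp)).mono
        (fun X' st'' h => ⟨h.1, ?_, fun x h4 h2 => ?_⟩) le_rfl
      · rw [h.2.1, List.length_cons, List.length_cons]; omega
      · rw [h.2.2 x h4 h2, Function.update_of_ne h2, Function.update_of_ne (by omega), hx x h4]

omit hW hS hU in
/-- Evaluate a term, whose variables are in the registers from `8` on, into register `b`. -/
def termProg : (expLang Ω).Term ℕ → ℕ → Prog (expLang Ω)
  | .var i, b => .assign b (.var (8 + i))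
  | .func (l := k) f ts, b => .seq (seqFin k fun i => termProg (ts i) (b + 1 + i))
      (.queryOp b f fun i => .var (b + 1 + i))

omit hW hS hU in
/-- The number of time units used by `termProg`. -/
def termCost : (expLang Ω).Term ℕ → ℕ
  | .var _ => 1
  | .func _ ts => ∑ i, termCost (ts i) + 2

omit hU in
-- The registers from `b` on serve as a stack. The value of argument `i` goes to `b + 1 + i`, and
-- its evaluation leaves all lower registers alone, so earlier arguments and the variables survive.
theorem impl_termProg (hSU : S ≤ U) {m : ℕ} (v : ℕ → D) (t : (expLang Ω).Term ℕ)
    (ht : ∀ i ∈ t.varFinset, i < m) (b : ℕ) (hb : 8 + m ≤ b) (st : Store)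
    (hv : ∀ i < m, st (8 + i) = enc (v i)) :
    Impl D O (termProg t b) st (.pure ()) (fun _ st' => st' b = enc (t.realize v) ∧
      ∀ x < b, st' x = st x) (termCost t * U) := by
  have hS0 : 4 * n + 4 ≤ S := le_trans (Nat.le_mul_of_pos_left _ (Nat.succ_pos _)) hS
  induction t generalizing b st with
  | var i =>
    have hi : st (8 + i) = enc (v i) := hv i (ht i (by simp [Term.varFinset]))
    refine .assign ⟨by simp [Expr.eval, hi], fun x hx => Function.update_of_ne (by omega) _ _⟩ ?_
    rw [Expr.eval, hi, termCost]
    have := one_add_size_enc_le hW hS0 (v i)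
    omega
  | @func k f ts ih =>
    let Inv : ℕ → Store → Prop := fun j st' =>
      (∀ i : Fin k, (i : ℕ) < j → st' (b + 1 + i) = enc ((ts i).realize v)) ∧
        ∀ x < b + 1, st' x = st x
    have hseq : Impl D O (seqFin k fun i => termProg (ts i) (b + 1 + i)) st (.pure ())
        (fun _ => Inv k) (∑ i, termCost (ts i) * U + 1) := by
      refine Impl.seqFin ⟨fun i hi => absurd hi (by omega), fun _ _ => rfl⟩ ?_
      rintro i st' ⟨h1, h2⟩
      refine (ih i (fun j hj => ht j ?_) (b + 1 + i) (by omega) st'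
        fun j hj => ?_).mono (fun _ st'' h => ⟨fun i' hi' => ?_, fun x hx => ?_⟩) le_rfl
      · simp only [Term.varFinset, Finset.mem_biUnion]; exact ⟨i, Finset.mem_univ i, hj⟩
      · rw [h2 _ (by omega), hv j hj]
      · by_cases hii : i' = i
        · subst hii; exact h.1
        · have : (i' : ℕ) ≠ i := fun h => hii (Fin.ext h)
          rw [h.2 _ (by omega), h1 i' (by omega)]
      · rw [h.2 x (by omega), h2 x hx]
    refine (hseq.seq_pure (T₂ := S) ?_).le ?_
    · rintro _ st' ⟨h1, h2⟩
      refine .queryOp hW (w := fun i => (ts i).realize v) (fun i => h1 i i.2)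
        ⟨by simp [Term.realize], fun x hx => ?_⟩ hS0
      rw [Function.update_of_ne (by omega), h2 x (by omega)]
    · rw [termCost, ← Finset.sum_mul]
      nlinarith

omit hW hS hU in
/-- Store `false` in register `3` if one of the identities does not hold. -/
def passesProg (m : ℕ) : List ((expLang Ω).Term ℕ × (expLang Ω).Term ℕ) → Prog (expLang Ω)
  | [] => skip
  | e :: ids => .seq (termProg e.1 (8 + m)) (.seq (termProg e.2 (8 + m + 1))
      (.seq (.queryEq 7 (.var (8 + m)) (.var (8 + m + 1)))
        (.seq (.cond (.var 7) skip (.assign 3 .nil)) (passesProg m ids))))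

omit hW hS hU in
/-- The number of time units used by `passesProg`. -/
def passesCost : List ((expLang Ω).Term ℕ × (expLang Ω).Term ℕ) → ℕ
  | [] => 1
  | e :: ids => termCost e.1 + termCost e.2 + 2 + passesCost ids

omit hU in
theorem impl_passesProg (hSU : S ≤ U) {m : ℕ} (v : ℕ → D)
    (ids : List ((expLang Ω).Term ℕ × (expLang Ω).Term ℕ))
    (hm : ∀ e ∈ ids, (∀ i ∈ e.1.varFinset, i < m) ∧ ∀ i ∈ e.2.varFinset, i < m) (ok : Bool)
    (st : Store) (h3 : st 3 = Data.bit ok) (hv : ∀ i < m, st (8 + i) = enc (v i)) :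
    Impl D O (passesProg m ids) st
      (.pure (passes ids (fun w₁ w₂ : D => O.eqv w₁ w₂) v ok)) (fun ok' st' =>
        st' 3 = Data.bit ok' ∧ ∀ x < 3, st' x = st x) (passesCost ids * U) := by
  have hS0 : 4 * n + 4 ≤ S := le_trans (Nat.le_mul_of_pos_left _ (Nat.succ_pos _)) hS
  induction ids generalizing ok st with
  | nil => exact .skip ⟨h3, fun _ _ => rfl⟩ (by rw [passesCost]; omega)
  | cons e ids ih =>
    obtain ⟨he1, he2⟩ := hm e (by simp)
    set ok' := ok && O.eqv (e.1.realize v : D) (e.2.realize v : D) with hok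
    refine Impl.le (T₁ := termCost e.1 * U + (termCost e.2 * U + (S + ((1 + 2) +
      passesCost ids * U)))) ?_ (by rw [passesCost]; nlinarith)
    refine Impl.seq (d := fun _ => .pure (passes ids (fun w₁ w₂ : D => O.eqv w₁ w₂) v ok'))
      (impl_termProg hW hS hSU v e.1 he1 (8 + m) le_rfl st hv) ?_
    rintro _ st₁ ⟨h11, h12⟩
    refine Impl.seq (d := fun _ => .pure (passes ids (fun w₁ w₂ : D => O.eqv w₁ w₂) v ok'))
      (impl_termProg hW hS hSU v e.2 he2 (8 + m + 1) (by omega) st₁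
        fun i hi => by rw [h12 _ (by omega), hv i hi]) ?_
    rintro _ st₂ ⟨h21, h22⟩
    refine Impl.seq (c := .pure ())
      (d := fun _ => .pure (passes ids (fun w₁ w₂ : D => O.eqv w₁ w₂) v ok'))
      (Post := fun _ st₃ => st₃ = Function.update st₂ 7
        (Data.bit (O.eqv (e.1.realize v : D) (e.2.realize v : D))))
      (.queryEq (by rw [Expr.eval, h22 _ (by omega), h11]) (by rw [Expr.eval, h21]) rfl
        (by omega)) ?_
    rintro _ _ rfl
    refine Impl.seq (c := .pure ())
      (d := fun _ => .pure (passes ids (fun w₁ w₂ : D => O.eqv w₁ w₂) v ok'))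
      (Post := fun _ st₃ => st₃ 3 = Data.bit ok' ∧ ∀ x, x ≠ 3 → x ≠ 7 → st₃ x = st₂ x) ?_ ?_
    · have h23 : st₂ 3 = Data.bit ok := by rw [h22 3 (by omega), h12 3 (by omega), h3]
      cases hq : O.eqv (e.1.realize v : D) (e.2.realize v : D) with
      | true =>
        refine .cond_true (by simp [Expr.eval, Data.bit]) (.skip ⟨?_, fun x h3 h7 => ?_⟩ (by omega))
        · rw [Function.update_of_ne (by omega), h23, hok, hq, Bool.and_true]
        · rw [Function.update_of_ne h7]
      | false =>
        refine .cond_false (by simp [Expr.eval, Data.bit]) (.assign ⟨?_, fun x h3 h7 => ?_⟩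
          (by simp [Expr.eval, Data.size]))
        · rw [hok, hq, Bool.and_false]; simp [Expr.eval, Data.bit]
        · rw [Function.update_of_ne h3, Function.update_of_ne h7]
    · rintro _ st₃ ⟨h33, h3x⟩
      refine (ih (fun e he => hm e (List.mem_cons_of_mem _ he)) ok' st₃ h33
        fun i hi => ?_).mono (fun _ st₄ h => ⟨h.1, fun x hx => ?_⟩) le_rfl
      · rw [h3x _ (by omega) (by omega), h22 _ (by omega), h12 _ (by omega), hv i hi]
      · rw [h.2 x hx, h3x x (by omega) (by omega), h22 x (by omega), h12 x (by omega)]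

theorem impl_check {X : List D} (hX : X.length ≤ ℓ) (R : ℕ) {m : ℕ}
    (ids : List ((expLang Ω).Term ℕ × (expLang Ω).Term ℕ))
    (hm : ∀ e ∈ ids, (∀ i ∈ e.1.varFinset, i < m) ∧ ∀ i ∈ e.2.varFinset, i < m) (ok : Bool)
    (st : Store) (h2 : st 2 = encList X) (h3 : st 3 = Data.bit ok) :
    Impl D O (.seq (drawProg Ω R m) (passesProg m ids)) st
      (check ids (fun w₁ w₂ : D => O.eqv w₁ w₂) X R m ok)
      (fun ok' st' => st' 3 = Data.bit ok' ∧ ∀ x < 3, st' x = st x)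
      ((m * (5 * R + 3) + 1 + passesCost ids) * U) := by
  have hSU : S ≤ U := le_trans (Nat.le_mul_of_pos_left _ (Nat.succ_pos _)) hU
  refine (Impl.seq (impl_drawProg hW hS hU hX R m st h2) (T₂ := passesCost ids * U) ?_).le
    (le_of_eq (by ring))
  rintro v st' ⟨hv, hx⟩
  refine (impl_passesProg hW hS hSU v ids hm ok st' (by rw [hx 3 (by omega), h3]) hv).mono
    (fun ok' st'' h => ⟨h.1, fun x hx' => ?_⟩) le_rfl
  rw [h.2 x hx', hx x (by omega)]

end Words

/-! ### The program -/

section Main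

variable {Ω : FirstOrder.Language.{u, u'}}

/-- The program for the random computation `testMember`. -/
def testProg (l : List (Σ k, Ω.Functions k))
    (ids : List ((expLang Ω).Term ℕ × (expLang Ω).Term ℕ)) (R m M₁ M₂ : ℕ) : Prog (expLang Ω) :=
  .seq (.assign 2 (.tl (.var 0))) (.seq (forProg (iterProg (growProg R l) M₁))
    (.seq (.assign 3 (.cons .nil .nil)) (.seq
      (forProg (iterProg (.seq (drawProg Ω R m) (passesProg m ids)) M₂)) (.assign 0 (.var 3)))))

/-- The factor in the bound for the running time. -/
def testCost (l : List (Σ k, Ω.Functions k))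
    (ids : List ((expLang Ω).Term ℕ × (expLang Ω).Term ℕ)) (R m M₁ M₂ : ℕ) : ℕ :=
  M₁ * growCost R l + M₂ * (m * (5 * R + 3) + 1 + passesCost ids) + 20

/-- The bound for the length of the list of generators. -/
def numGen (M₁ q n k : ℕ) : ℕ := k + n * (M₁ * q)

/-- Each of the `n * M₁` rounds adds exactly `l.length` words, so the list never exceeds `numGen`.
The `M₁`- and `M₂`-fold repetitions are written out in the program; only the repetition `n` times is
a loop over the input. -/
theorem impl_testProg {D : Set (List Bool)} {O : Oracle (expLang Ω)} [(expLang Ω).Structure D]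
    {n : ℕ} (hW : IsWordAlgebra D O n) (l : List (Σ k, Ω.Functions k))
    (ids : List ((expLang Ω).Term ℕ × (expLang Ω).Term ℕ)) (R m M₁ M₂ : ℕ)
    (hm : ∀ e ∈ ids, (∀ i ∈ e.1.varFinset, i < m) ∧ ∀ i ∈ e.2.varFinset, i < m) (s : List D) :
    Impl D O (testProg l ids R m M₁ M₂)
      (Function.update (fun _ => Data.nil) 0 (Data.input n (s.map Subtype.val)))
      (testMember l ids R m M₁ M₂ n (fun w₁ w₂ : D => O.eqv w₁ w₂) s)
      (fun b st => st 0 = Data.bit b)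
      (testCost l ids R m M₁ M₂ * (n + 1) * ((numGen M₁ l.length n s.length + 1) *
        ((numGen M₁ l.length n s.length + 1) * (4 * n + 4)))) := by
  set ℓ := numGen M₁ l.length n s.length with hℓ
  obtain ⟨S, hS⟩ : ∃ S, S = (ℓ + 1) * (4 * n + 4) := ⟨_, rfl⟩
  obtain ⟨U, hU⟩ : ∃ U, U = (ℓ + 1) * S := ⟨_, rfl⟩
  rw [← hS, ← hU]
  have hSle : (ℓ + 1) * (4 * n + 4) ≤ S := hS.ge
  have hUle : (ℓ + 1) * S ≤ U := hU.ge
  have hS0 : 4 * n + 4 ≤ S := le_trans (Nat.le_mul_of_pos_left _ (Nat.succ_pos _)) hSle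
  have hSU : S ≤ U := le_trans (Nat.le_mul_of_pos_left _ (Nat.succ_pos _)) hUle
  set d := Data.input n (s.map Subtype.val) with hd
  have hhd : d.hd = Data.word (List.replicate n true) := rfl
  have htl : d.tl = encList s := by
    simp only [hd, Data.input, Data.tl, encList, List.map_map]
    rfl
  refine Impl.le (T₁ := S + ((S + (n * (1 + S + (M₁ * (growCost R l * U) + 1)) + 1)) + (4 +
    ((S + (n * (1 + S + (M₂ * ((m * (5 * R + 3) + 1 + passesCost ids) * U) + 1)) + 1)) + 4)))) ?_ ?_
  · refine Impl.seq (c := .pure ()) (d := fun _ => testMember l ids R m M₁ M₂ n _ s)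
      (Post := fun _ st => st 0 = d ∧ st 2 = encList s) (.assign ⟨by simp, ?_⟩ ?_) ?_
    · simpa [Expr.eval] using htl
    · simp only [Expr.eval, Function.update_self]
      rw [htl]
      have := size_encList_le hW.length s
      have : s.length ≤ ℓ := Nat.le_add_right _ _
      nlinarith
    rintro _ st₁ ⟨h10, h12⟩
    refine Impl.seq (Impl.forProg (n := n) (S := S) (T := M₁ * (growCost R l * U) + 1)
      (f := iter (grow s R l) M₁) (a := [])
      -- The invariant keeps track of the exact length of `X`, since this length bounds the cost of
      -- the following rounds.
      (Inv := fun i X st => st 0 = d ∧ st 2 = encList (X ++ s) ∧ X.length = i * (M₁ * l.length))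
      (by omega) ⟨h10, h12, by simp⟩ (by rw [h10, hhd]) ?_ ?_) ?_
    · rintro i X st d' ⟨h0, h2, hX⟩
      exact ⟨by simpa using h0, by simpa using h2, hX⟩
    · rintro i X st hi ⟨h0, h2, hX⟩
      refine (Impl.iterProg (i := 0) (T := growCost R l * U)
        (Inv := fun j X' st' => st' 0 = d ∧ st' 2 = encList (X' ++ s) ∧
          X'.length = i * (M₁ * l.length) + j * l.length ∧ st' 1 = st 1)
        ⟨h0, h2, by simp [hX], rfl⟩ ?_).mono ?_ le_rfl
      · rintro j X' st' hj ⟨h0', h2', hX', h1'⟩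
        have hb : X'.length + l.length + s.length ≤ ℓ := by
          have e1 : (j + 1) * l.length ≤ M₁ * l.length := Nat.mul_le_mul_right _ (by omega)
          have e2 : (i + 1) * (M₁ * l.length) ≤ n * (M₁ * l.length) :=
            Nat.mul_le_mul_right _ (by omega)
          rw [Nat.add_mul] at e1 e2
          rw [hℓ, numGen]
          omega
        refine (impl_growProg hW hSle hUle R l X' hb st' h2').mono ?_ le_rfl
        rintro Y st'' ⟨g2, gX, gx⟩
        refine ⟨by rw [gx 0 (by omega) (by omega), h0'], g2, ?_, by
          rw [gx 1 (by omega) (by omega), h1']⟩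
        rw [gX, hX', Nat.succ_mul j, Nat.add_assoc]
      · rintro Y st' ⟨g0, g2, gX, g1⟩
        refine ⟨⟨g0, g2, ?_⟩, g1⟩
        rw [gX, zero_add, Nat.succ_mul i]
    rintro X st₂ ⟨h20, h22, hX⟩
    refine Impl.seq (c := .pure ())
      (d := fun _ => iter (iter (check ids _ (X ++ s) R m) M₂) n true)
      (Post := fun _ st => st 0 = d ∧ st 2 = encList (X ++ s) ∧ st 3 = Data.bit true)
      (.assign ⟨by simpa using h20, by simpa using h22, by simp [Expr.eval, Data.bit]⟩
        (by simp [Expr.eval, Data.size])) ?_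
    rintro _ st₃ ⟨h30, h32, h33⟩
    have hXl : (X ++ s).length ≤ ℓ := by
      rw [List.length_append, hX, hℓ, numGen]; omega
    refine Impl.seq_pure (Impl.forProg (n := n) (S := S)
      (T := M₂ * ((m * (5 * R + 3) + 1 + passesCost ids) * U) + 1)
      (f := iter (check ids (fun w₁ w₂ : D => O.eqv w₁ w₂) (X ++ s) R m) M₂) (a := true)
      (Inv := fun _ ok st => st 0 = d ∧ st 2 = encList (X ++ s) ∧ st 3 = Data.bit ok)
      (by omega) ⟨h30, h32, h33⟩ (by rw [h30, hhd]) ?_ ?_) ?_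
    · rintro i ok st d' ⟨h0, h2, h3⟩
      exact ⟨by simpa using h0, by simpa using h2, by simpa using h3⟩
    · rintro i ok st _ ⟨h0, h2, h3⟩
      refine (Impl.iterProg (i := 0) (T := (m * (5 * R + 3) + 1 + passesCost ids) * U)
        (Inv := fun _ ok st' => (st' 0 = d ∧ st' 2 = encList (X ++ s) ∧ st' 3 = Data.bit ok) ∧
          st' 1 = st 1) ⟨⟨h0, h2, h3⟩, rfl⟩ ?_).mono (fun _ _ h => h) le_rfl
      rintro j ok' st' - ⟨⟨h0', h2', h3'⟩, h1'⟩
      refine (impl_check hW hSle hUle hXl R ids hm ok' st' h2' h3').mono ?_ le_rfl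
      rintro ok'' st'' ⟨g3, gx⟩
      exact ⟨⟨by rw [gx 0 (by omega), h0'], by rw [gx 2 (by omega), h2'], g3⟩, by
        rw [gx 1 (by omega), h1']⟩
    rintro ok st₄ ⟨-, -, h43⟩
    refine .assign (by simpa [Expr.eval] using h43) ?_
    rw [Expr.eval, h43]
    have := size_bit_le ok
    omega
  · rw [testCost]
    have h1 : n * S ≤ n * U := Nat.mul_le_mul_left _ hSU
    have h2 : n ≤ n * U := Nat.le_mul_of_pos_right _ (by omega)
    have h3 : 4 ≤ U := by omega
    generalize growCost R l = g
    generalize m * (5 * R + 3) + 1 + passesCost ids = g'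
    have e1 : n * (1 + S + (M₁ * (g * U) + 1)) = n + n * S + n * (M₁ * g * U) + n := by ring
    have e2 : n * (1 + S + (M₂ * (g' * U) + 1)) = n + n * S + n * (M₂ * g' * U) + n := by ring
    have e3 : (M₁ * g + M₂ * g' + 20) * (n + 1) * U =
      n * (M₁ * g * U) + M₁ * g * U + n * (M₂ * g' * U) + M₂ * g' * U + 20 * (n * U) + 20 * U := by
      ring
    rw [e1, e2, e3]
    omega

theorem length_le_size_word (w : List Bool) : w.length ≤ (Data.word w).size := by
  induction w with
  | nil => simp
  | cons b w ih =>
    simp only [Data.word, List.map_cons, Data.list, Data.size, List.length_cons] at ih ⊢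
    omega

theorem length_le_size_list (X : List Data) : X.length ≤ (Data.list X).size := by
  induction X with
  | nil => simp
  | cons b w ih =>
    simp only [Data.list, Data.size, List.length_cons] at ih ⊢
    omega

/-- The bound for the running time, as a polynomial in the length of the input. -/
noncomputable def testPoly (κ a : ℕ) : Polynomial ℕ :=
  Polynomial.C κ * (Polynomial.X + 1) * ((Polynomial.X + Polynomial.X * Polynomial.C a + 1) *
    ((Polynomial.X + Polynomial.X * Polynomial.C a + 1) * (4 * Polynomial.X + 4)))

theorem le_eval_testPoly (κ M₁ q n : ℕ) (s : List (List Bool)) :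
    κ * (n + 1) * ((numGen M₁ q n s.length + 1) * ((numGen M₁ q n s.length + 1) * (4 * n + 4))) ≤
      (testPoly κ (M₁ * q)).eval (Data.input n s).size := by
  have h1 : n ≤ (Data.input n s).size := by
    have := length_le_size_word (List.replicate n true)
    rw [List.length_replicate] at this
    simp only [Data.input, Data.size]; omega
  have h2 : s.length ≤ (Data.input n s).size := by
    have := length_le_size_list (s.map Data.word)
    rw [List.length_map] at this
    simp only [Data.input, Data.size]; omega
  generalize (Data.input n s).size = z at *
  simp only [testPoly, Polynomial.eval_mul, Polynomial.eval_add, Polynomial.eval_C,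
    Polynomial.eval_X, Polynomial.eval_one, Polynomial.eval_ofNat, numGen]
  gcongr

end Main

/-! ### The algebra of representations, and output probabilities -/

namespace BlackBox

variable {Ω : FirstOrder.Language.{u, u'}} {H : Type v} [(expLang Ω).Structure H] {n : ℕ}
  {B : BlackBox H n} {O : Oracle (expLang Ω)}

/-- The algebra structure on the representations that is defined by the oracle. -/
@[reducible] def wordStructure (hO : B.IsOracle O) : (expLang Ω).Structure B.dom where
  funMap f w := ⟨O.op f fun i => w i, (hO.op f w).1⟩
  RelMap _ _ := False

theorem isWordAlgebra (hO : B.IsOracle O) :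
    letI := wordStructure hO
    IsWordAlgebra B.dom O n :=
  letI := wordStructure hO
  { length := B.length_eq
    op := fun _ _ => rfl }

/-- The representations need not satisfy the group laws, but `rep` is a homomorphism from their
algebra to `H`. This is the only link that the analysis needs between computed words and elements of
`H`. -/
theorem rep_funMap (hO : B.IsOracle O) {k : ℕ} (f : (expLang Ω).Functions k)
    (w : Fin k → B.dom) :
    letI := wordStructure hO
    B.rep (FirstOrder.Language.Structure.funMap f w) =
      FirstOrder.Language.Structure.funMap f fun i => B.rep (w i) :=
  (hO.op f w).2

omit [(expLang Ω).Structure H] in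
theorem finite_dom (B : BlackBox H n) : Finite B.dom ∧ Nat.card B.dom ≤ 2 ^ n := by
  let g : B.dom → List.Vector Bool n := fun w => ⟨w, B.length_eq _ w.2⟩
  have hg : Function.Injective g := fun a b h => Subtype.ext (congr_arg (fun x : List.Vector Bool n => x.1) h)
  refine ⟨Finite.of_injective g hg, (Nat.card_le_card_of_injective g hg).trans ?_⟩
  rw [Nat.card_eq_fintype_card, card_vector, Fintype.card_bool]

theorem finite (B : BlackBox H n) : Finite H ∧ Nat.card H ≤ 2 ^ n := by
  have := B.finite_dom.1
  exact ⟨Finite.of_surjective _ B.surjective,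
    (Nat.card_le_card_of_surjective _ B.surjective).trans B.finite_dom.2⟩

end BlackBox

theorem sum_ind {ι : Type*} [Fintype ι] (p : ι → Prop) :
    ∑ i, ind (p i) = ({i | p i}.ncard : ℝ) := by
  classical
  have : ∀ i, ind (p i) = if p i then 1 else 0 := fun i => by unfold ind; congr
  simp only [this]
  rw [Finset.sum_boole, Set.ncard_eq_toFinset_card']
  simp

/-- The expectation over the tree equals the average over all toss sequences of the fixed length
`T'`, because surplus tosses do not influence the value; and the program outputs the value of the
tree. -/
theorem le_outputProb {L : FirstOrder.Language.{u, u'}} {D : Set (List Bool)} {O : Oracle L}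
    {P : Prog L} {d : Data} {c : Coin Bool} {T T' : ℕ}
    (h : Impl D O P (Function.update (fun _ => Data.nil) 0 d) c (fun b st => st 0 = Data.bit b) T)
    (hT : T ≤ T') (b : Bool) :
    c.E (fun b' => ind (b' = b)) ≤ outputProb D O P d T' (Data.bit b) := by
  have hrun : ∀ r : List Bool, r.length = T' → ∃ a r', c.run r = some (a, r') := fun r hr => by
    obtain ⟨a, r', _, _, h1, _⟩ := h r (by omega)
    exact ⟨a, r', h1⟩
  have hsum := c.sum_run (fun b' => b' = b) T' hrun
  have hcard : ∑ r : Fin T' → Bool, ind (∃ a r', c.run (List.ofFn r) = some (a, r') ∧ a = b) ≤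
      ({r : Fin T' → Bool | HaltsWith D O P d (List.ofFn r) T' (Data.bit b)}.ncard : ℝ) := by
    rw [sum_ind]
    refine Nat.cast_le.2 (Set.ncard_le_ncard ?_ (Set.toFinite _))
    rintro r ⟨a, r', h1, rfl⟩
    obtain ⟨a', r'', st', t, h1', h2, h3, h4⟩ := h (List.ofFn r) (by simpa using hT)
    rw [h1] at h1'
    cases h1'
    exact ⟨st', r', t, h2, h3.trans hT, h4⟩
  rw [outputProb, le_div_iff₀ (by positivity), mul_comm, ← hsum]
  exact hcard

theorem exists_forall_mem_le {α : Type*} (l : List α) (f : α → ℕ) : ∃ b, ∀ x ∈ l, f x ≤ b := by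
  induction l with
  | nil => exact ⟨0, by simp⟩
  | cons a l ih =>
    obtain ⟨b, hb⟩ := ih
    refine ⟨max (f a) b, fun x hx => ?_⟩
    rcases List.mem_cons.1 hx with rfl | hx
    · exact le_max_left _ _
    · exact (hb x hx).trans (le_max_right _ _)

/-- A random assignment of the variables fails one of the identities with probability bounded away
from zero, if the algebra is not in the variety. -/
theorem E_passes_le {Ω : FirstOrder.Language.{u, u'}} {H : Type v} [(expLang Ω).Structure H]
    [Group H] {W : Type} [(expLang Ω).Structure W] {ρ : W → H}
    (hρ : ∀ {k : ℕ} (f : (expLang Ω).Functions k) (x : Fin k → W),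
      ρ (FirstOrder.Language.Structure.funMap f x) =
        FirstOrder.Language.Structure.funMap f fun i => ρ (x i))
    (hG : IsGroupOf Ω H) (hH : IsDistributive Ω H) {eqv : W → W → Bool}
    (heqv : ∀ a b, eqv a b = true → ρ a = ρ b)
    {B : List ((expLang Ω).Term ℕ × (expLang Ω).Term ℕ)} {d D m : ℕ}
    (hD : ∀ e ∈ B, deg d e.1 ≤ D ∧ deg d e.2 ≤ D) (hdm : d < m)
    (hm : ∀ e ∈ B, (∀ i ∈ e.1.varFinset, i < m) ∧ ∀ i ∈ e.2.varFinset, i < m)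
    (hB : ∃ e ∈ B, ¬ Satisfies (expLang Ω) H e) {L : List W} (hL : span ρ L = ⊤) :
    (drawSums Ω L (d * D + 1) m).E
      (fun v => ind (passes ((nilTerm Ω d, zeroTerm Ω) :: B) eqv v true = true)) ≤
      1 - ((1 / 2) ^ (d * D + 1)) ^ m := by
  have hp : ∀ e ∈ (nilTerm Ω d, zeroTerm Ω) :: B, ∀ v : ℕ → W,
      passes ((nilTerm Ω d, zeroTerm Ω) :: B) eqv v true = true →
        e.1.realize (fun i => ρ (v i)) = e.2.realize fun i => ρ (v i) := by
    intro e he v h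
    rw [passes_eq] at h
    rw [← map_realize hρ, ← map_realize hρ]
    exact heqv _ _ (h.2 e he)
  -- If the class is at most `d`, terms are polynomial maps and the failing identity of `B` is
  -- detected. If not, the adjoined commutator law is likely to fail.
  by_cases hd : (⊤ : Subgroup H).lowerCentralSeries d = ⊥
  · obtain ⟨e, he, hne⟩ := hB
    exact (E_mono fun v _ => ind_mono (hp e (List.mem_cons_of_mem _ he) v)).trans
      (E_draw_realize_le (map_addOp hρ hG) hG hH hd hL (map_zeroOp hρ hG) hne (hD e he).1 (hD e he).2
        (hm e he).1 (hm e he).2 _)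
  · refine (E_mono fun v _ => ind_mono fun h => ?_).trans
      ((E_draw_leftComm_le (map_addOp hρ hG) hd hL (zeroOp Ω W) (Nat.succ_pos _) hdm _).trans ?_)
    · have := hp _ List.mem_cons_self v h
      rwa [realize_nilTerm hG, realize_zeroTerm, hG.one] at this
    · refine sub_le_sub_left (pow_le_pow_left₀ (by positivity) ?_ m) 1
      exact pow_le_of_le_one (by norm_num) (by norm_num) (Nat.succ_ne_zero _)

end BlackBoxModel

/-! ### The theorem: choice of the constants and the error bound -/

open BlackBoxModel in
theorem theoremt (Ω : FirstOrder.Language.{u, u'}) [Ω.IsAlgebraic] [Finite (Σ k, Ω.Functions k)]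
    (V : AlgClass.{u, u', v} (expLang Ω)) (hV : IsFinitelyBasedVariety V)
    (hdist : ∀ (H : Type v) [(expLang Ω).Structure H], V H → IsDistributive Ω H)
    (hnil : ∀ (H : Type v) [(expLang Ω).Structure H], V H → HasNilpotentAddGroup Ω H)
    (c : ℝ) (hc : 1 < c) :
    ∃ (D : Prog (expLang Ω)) (p : Polynomial ℕ), IsBlackBoxAlgorithm.{u, u', v} D p ∧
      ∀ (H : Type v) [(expLang Ω).Structure H], IsDistributive Ω H →
        ∀ (n : ℕ) (B : BlackBox H n) (O : Oracle (expLang Ω)), B.IsOracle O →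
          ∀ s : List B.dom, Generates (expLang Ω) B s →
            1 - (n : ℝ) / c ^ n ≤
              outputProb B.dom O D (Data.input n (s.map Subtype.val))
                (p.eval (Data.input n (s.map Subtype.val)).size) (answer (V H)) := by
  obtain ⟨d, hd⟩ := exists_nilTerm_of_variety hV hnil
  obtain ⟨B₀, hB₀, hVB⟩ := hV
  obtain ⟨B, hB⟩ : ∃ B : List ((expLang Ω).Term ℕ × (expLang Ω).Term ℕ), ∀ e, e ∈ B ↔ e ∈ B₀ :=
    ⟨hB₀.toFinset.toList, fun e => by simp⟩
  obtain ⟨l, hl⟩ : ∃ l : List (Σ k, Ω.Functions k), ∀ ω, ω ∈ l := by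
    have := Fintype.ofFinite (Σ k, Ω.Functions k)
    exact ⟨Finset.univ.toList, fun ω => by simp⟩
  obtain ⟨D₀, hD₀⟩ := exists_forall_mem_le B fun e => deg d e.1 + deg d e.2
  obtain ⟨m₀, hm₀⟩ := exists_forall_mem_le B fun e => e.1.varFinset.sup id + e.2.varFinset.sup id
  obtain ⟨K, hK⟩ := exists_forall_mem_le l fun ω => ω.1
  -- `m` exceeds the indices of all variables in the basis and in the commutator law.
  set m := m₀ + d + 1 with hm_def
  set R := d * D₀ + 1 with hR
  have hD : ∀ e ∈ B, deg d e.1 ≤ D₀ ∧ deg d e.2 ≤ D₀ := fun e he => by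
    have := hD₀ e he
    exact ⟨by omega, by omega⟩
  have hm : ∀ e ∈ B, (∀ i ∈ e.1.varFinset, i < m) ∧ ∀ i ∈ e.2.varFinset, i < m := fun e he => by
    have := hm₀ e he
    refine ⟨fun i hi => ?_, fun i hi => ?_⟩
    · have : i ≤ e.1.varFinset.sup id := Finset.le_sup (f := id) hi
      omega
    · have : i ≤ e.2.varFinset.sup id := Finset.le_sup (f := id) hi
      omega
  set ids := (nilTerm Ω d, zeroTerm Ω) :: B with hids
  have hm' : ∀ e ∈ ids, (∀ i ∈ e.1.varFinset, i < m) ∧ ∀ i ∈ e.2.varFinset, i < m := by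
    intro e he
    rcases List.mem_cons.1 he with rfl | he
    · refine ⟨fun i hi => ?_, fun i hi => ?_⟩
      · have := lt_of_mem_nilTerm Ω hi
        omega
      · simp [zeroTerm, FirstOrder.Language.Term.varFinset] at hi
    · exact hm e he
  set q₁ : ℝ := 1 - (1 / 2) ^ (K + 1) with hq₁
  set q₂ : ℝ := 1 - ((1 / 2) ^ R) ^ m with hq₂
  have hq₁' : q₁ < 1 := by
    have : (0 : ℝ) < (1 / 2) ^ (K + 1) := by positivity
    linarith
  have hq₂' : q₂ < 1 := by
    have : (0 : ℝ) < ((1 / 2) ^ R) ^ m := by positivity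
    linarith
  have hq₁0 : 0 ≤ q₁ := by
    have : ((1 : ℝ) / 2) ^ (K + 1) ≤ 1 := pow_le_one₀ (by norm_num) (by norm_num)
    linarith
  have hq₂0 : 0 ≤ q₂ := by
    have : (((1 : ℝ) / 2) ^ R) ^ m ≤ 1 :=
      pow_le_one₀ (by positivity) (pow_le_one₀ (by norm_num) (by norm_num))
    linarith
  have hc0 : 0 < c := by linarith
  -- In `4 * c`, one factor 2 pays for the initial index, which is at most `2 ^ n`. Then both phases
  -- fail with probability at most `(2 * c) ^ (-n)`.
  obtain ⟨M₁, hM₁⟩ := exists_pow_lt_of_lt_one (show 0 < 1 / (4 * c) by positivity) hq₁'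
  obtain ⟨M₂, hM₂⟩ := exists_pow_lt_of_lt_one (show 0 < 1 / (2 * c) by positivity) hq₂'
  refine ⟨testProg l ids R m M₁ M₂, testPoly (testCost l ids R m M₁ M₂) (M₁ * l.length), ?_, ?_⟩
  -- The time bound comes from the algebra of representations alone, so it holds in every black-box
  -- algebra.
  · intro H _ n B O hO s d' r hr
    let := BlackBox.wordStructure hO
    have h := impl_testProg (BlackBox.isWordAlgebra hO) l ids R m M₁ M₂ hm' s
    have hle := le_eval_testPoly (testCost l ids R m M₁ M₂) M₁ l.length n (s.map Subtype.val)
    rw [List.length_map] at hle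
    obtain ⟨a, r', st', t, -, h2, h3, h4⟩ := h r (by rw [hr]; exact hle)
    exact ⟨_, st', r', t, h2, h3.trans hle, h4⟩
  · intro H _ hH n BB O hO s hs
    let := BlackBox.wordStructure hO
    let := hH.isExpandedGroup.group
    have hG : IsGroupOf Ω H := ⟨fun _ _ => rfl, fun _ => rfl, rfl⟩
    obtain ⟨hfin, hcard⟩ := BB.finite
    have hle := le_eval_testPoly (testCost l ids R m M₁ M₂) M₁ l.length n (s.map Subtype.val)
    rw [List.length_map] at hle
    refine le_trans ?_ (le_outputProb
      (impl_testProg (BlackBox.isWordAlgebra hO) l ids R m M₁ M₂ hm' s) hle _)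
    by_cases hVH : V H
    · have h1 := E_testMember_eq_one (l := l) (ids := ids) (R := R) (m := m) (M₁ := M₁) (M₂ := M₂)
        (n := n) (eqv := fun w₁ w₂ : BB.dom => O.eqv w₁ w₂) (s := s) fun e he v => by
          rw [hO.eqv, map_realize (BlackBox.rep_funMap hO), map_realize (BlackBox.rep_funMap hO)]
          rcases List.mem_cons.1 he with rfl | he
          · exact hd H hVH _
          · exact (hVB H).1 hVH e ((hB e).1 he) _
      simp only [hVH, decide_true, h1]
      have : 0 ≤ (n : ℝ) / c ^ n := by positivity
      linarith
    · have hne : ∃ e ∈ B, ¬ Satisfies (expLang Ω) H e := by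
        by_contra! h
        exact hVH ((hVB H).2 fun e he => h e ((hB e).2 he))
      -- For `n = 0` no error is allowed. But then `H` has at most one element and satisfies all
      -- identities.
      have hn : n ≠ 0 := by
        rintro rfl
        obtain ⟨e, -, he⟩ := hne
        have : Subsingleton H := (Finite.card_le_one_iff_subsingleton).1 (by simpa using hcard)
        exact he fun a => Subsingleton.elim _ _
      have h1 := E_testMember_le (ρ := BB.rep) (BlackBox.rep_funMap hO) hG hH (s := s) hs
        (R := R) (Nat.succ_pos _) hl hK (ids := ids)
        (eqv := fun w₁ w₂ : BB.dom => O.eqv w₁ w₂) (m := m) hq₂0 (fun L hL =>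
          E_passes_le (BlackBox.rep_funMap hO) hG hH (fun a b h => (hO.eqv a b).1 h) hD
            (by omega) hm hne hL) M₁ M₂ n
      have h2 : ∀ b : Bool, ind (b = false) = 1 + (-1) * ind (b = true) := by
        intro b; cases b <;> simp [ind]
      simp only [hVH, decide_false, h2, Coin.E_affine]
      have hcardR : (Nat.card H : ℝ) ≤ 2 ^ n := by exact_mod_cast hcard
      have h3 : (q₁ ^ M₁) ^ n * Nat.card H ≤ (1 / (2 * c)) ^ n := by
        calc (q₁ ^ M₁) ^ n * Nat.card H ≤ (1 / (4 * c)) ^ n * 2 ^ n := by gcongr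
          _ = (1 / (2 * c)) ^ n := by rw [← mul_pow]; congr 1; field_simp; norm_num
      have h4 : (q₂ ^ M₂) ^ n ≤ (1 / (2 * c)) ^ n := by gcongr
      -- The two errors add up to `2 * (1 / 2) ^ n / c ^ n`, where `2 * (1 / 2) ^ n ≤ 1 ≤ n`.
      have h5 : (1 / (2 * c)) ^ n + (1 / (2 * c)) ^ n ≤ n / c ^ n := by
        have hn1 : (1 : ℝ) ≤ n := by exact_mod_cast Nat.one_le_iff_ne_zero.2 hn
        have h6 : ((1 : ℝ) / 2) ^ n ≤ 1 / 2 := pow_le_of_le_one (by norm_num) (by norm_num) hn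
        have h7 : (1 / (2 * c)) ^ n = (1 / 2) ^ n / c ^ n := by rw [← div_pow]; congr 1; field_simp
        rw [h7, ← add_div]
        gcongr
        linarith
      linarith
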